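/- Let $n\ge 1$ and $s\in(0,1)$, and put $c_{n,s}=\frac{2^s\,\Gamma\left(\frac{n+s}{2}\right)}{\pi^{n/2}\,|\Gamma(-\frac s2)|}$. For a measurable set $E\subset\mathbb R^n$ with $|E|<\infty$ let $$P(E)=\sup\Big\{\int_E \mathrm{div}\, g\,dx \;;\; g\in C^1_c(\mathbb R^n;\mathbb R^n),\ |g|\le 1\Big\}\in[0,\infty],\qquad P_s(E)=\frac12\int_{\mathbb R^n}\int_{\mathbb R^n}\frac{|\chi_E(x)-\chi_E(y)|}{|x-y|^{n+s}}\,dx\,dy .$$ For every $\varepsilon>0$ and every such $E$ the equation $$\phi+\varepsilon^s(-\Delta)^{s/2}\phi=\chi_E\quad\text{in }\mathbb R^n,\qquad (-\Delta)^{s/2}u(x)=c_{n,s}\,\mathrm{PV}\int_{\mathbb R^n}\frac{u(x)-u(y)}{|x-y|^{n+s}}\,dy,$$ understood in the sense of distributions (that is, $\int\phi\,\eta\,dx+\varepsilon^s\int\phi\,(-\Delta)^{s/2}\eta\,dx=\int_E\eta\,dx$ for all $\eta\in C_c^\infty(\mathbb R^n)$), has a solution $\phi_E^\varepsilon\in L^\infty(\mathbb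 R^n)$, and it is unique up to null sets. Let $$\mathscr J^s_\varepsilon(E)=\varepsilon^{-s}\int_{\mathbb R^n}\chi_E\,(1-\phi_E^\varepsilon)\,dx .$$ Then, for every $t>0$, the functionals $\mathscr G^s_\varepsilon(E)=P(E)-t\,\mathscr J^s_\varepsilon(E)$ $\Gamma$-converge, as $\varepsilon\to0^+$, with respect to $L^1(\mathbb R^n)$ convergence of characteristic functions, to $$\mathscr G^s_0(E)=P(E)-t\,c_{n,s}P_s(E),$$ where $\mathscr G^s_0(E)=+\infty$ if $P(E)=\infty$. That is, for every measurable $E\subset\mathbb R^n$ with $|E|<\infty$: (i) for every family $(E_\varepsilon)_{\varepsilon>0}$ of measurable sets of finite measure with $|E_\varepsilon\,\triangle\,E|\to0$ as $\varepsilon\to 0^+$, $\ \liminf_{\varepsilon\to0^+}\mathscr G^s_\varepsilon(E_\varepsilon)\ge\mathscr G^s_0(E)$; (ii) there is a family $(E_\varepsilon)_{\varepsilon>0}$ of measurable sets of finite measure with $|E_\varepsilon\,\triangle\,E|\to0$ as $\varepsilon\to 0^+$ and $\ \limsup_{\varepsilon\to0^+}\mathscr G^s_\varepsilon(E_\varepsilon)\le\mathscr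 G^s_0(E)$. -/

import Mathlib

open MeasureTheory Set Filter Topology
open scoped ENNReal symmDiff ContDiff

noncomputable section

/-- The constant `c_{n,s} = 2^s Γ((n+s)/2) / (π^{n/2} |Γ(-s/2)|)`. -/
def fracConst (n : ℕ) (s : ℝ) : ℝ :=
  (2 : ℝ) ^ s * Real.Gamma (((n : ℝ) + s) / 2) /
    (Real.pi ^ ((n : ℝ) / 2) * |Real.Gamma (-s / 2)|)

/-- The fractional Laplacian `(-Δ)^{s/2} u (x) = c_{n,s} PV ∫ (u(x) - u(y)) / |x-y|^{n+s} dy`,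
the principal value being the limit of the integrals over the complements of the balls
`B_r(x)` as `r → 0⁺`. -/
def fracLaplacian (n : ℕ) (s : ℝ) (u : EuclideanSpace ℝ (Fin n) → ℝ)
    (x : EuclideanSpace ℝ (Fin n)) : ℝ :=
  fracConst n s * limUnder (𝓝[>] (0 : ℝ)) fun r =>
    ∫ y in (Metric.ball x r)ᶜ, (u x - u y) / ‖x - y‖ ^ ((n : ℝ) + s)

/-- The divergence of a vector field on `ℝⁿ`. -/
def divergence (n : ℕ) (g : EuclideanSpace ℝ (Fin n) → EuclideanSpace ℝ (Fin n))
    (x : EuclideanSpace ℝ (Fin n)) : ℝ :=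
  ∑ i, (fderiv ℝ g x (EuclideanSpace.single i 1)) i

/-- The perimeter `P(E)`: the supremum of `∫_E div g` over the compactly supported `C¹` vector
fields `g` with `|g| ≤ 1`. (The integrals are finite, and `g = 0` is admissible, so that passing
to `ENNReal` by `ENNReal.ofReal` does not change the supremum.) -/
def perimeter (n : ℕ) (E : Set (EuclideanSpace ℝ (Fin n))) : ℝ≥0∞ :=
  ⨆ (g : EuclideanSpace ℝ (Fin n) → EuclideanSpace ℝ (Fin n)) (_ : ContDiff ℝ 1 g)
    (_ : HasCompactSupport g) (_ : ∀ x, ‖g x‖ ≤ 1),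
    ENNReal.ofReal (∫ x in E, divergence n g x)

/-- The `s`-perimeter
`P_s(E) = (1/2) ∫∫ |χ_E(x) - χ_E(y)| / |x-y|^{n+s} dx dy`. -/
def fracPerimeter (n : ℕ) (s : ℝ) (E : Set (EuclideanSpace ℝ (Fin n))) : ℝ≥0∞ :=
  2⁻¹ * ∫⁻ x : EuclideanSpace ℝ (Fin n), ∫⁻ y : EuclideanSpace ℝ (Fin n),
    ENNReal.ofReal
      (|E.indicator (fun _ => (1 : ℝ)) x - E.indicator (fun _ => (1 : ℝ)) y| /
        ‖x - y‖ ^ ((n : ℝ) + s))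

/-- `φ` is a bounded solution of `φ + ε^s (-Δ)^{s/2} φ = χ_E` in `ℝⁿ`. As `χ_E` is discontinuous,
the equation is understood in the sense of distributions. -/
def IsBoundedSolution (n : ℕ) (s ε : ℝ) (E : Set (EuclideanSpace ℝ (Fin n)))
    (φ : EuclideanSpace ℝ (Fin n) → ℝ) : Prop :=
  MemLp φ (⊤ : ℝ≥0∞) volume ∧
    ∀ η : EuclideanSpace ℝ (Fin n) → ℝ, ContDiff ℝ ∞ η → HasCompactSupport η →
      (∫ x, φ x * η x) + ε ^ s * ∫ x, φ x * fracLaplacian n s η x = ∫ x in E, η x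

open Classical in
/-- The potential `φ_E^ε`: the bounded solution of `φ + ε^s (-Δ)^{s/2} φ = χ_E` in `ℝⁿ`
(unique up to a null set, which does not affect integrals of it). -/
def potential (n : ℕ) (s ε : ℝ) (E : Set (EuclideanSpace ℝ (Fin n))) :
    EuclideanSpace ℝ (Fin n) → ℝ :=
  if h : ∃ φ, IsBoundedSolution n s ε E φ then h.choose else 0

/-- The functional `J^s_ε(E) = ε^{-s} ∫ χ_E (1 - φ_E^ε) dx`, for `s ∈ (0,1)`. -/
def nonlocalEnergy (n : ℕ) (s ε : ℝ) (E : Set (EuclideanSpace ℝ (Fin n))) : ℝ :=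
  ε ^ (-s) * ∫ x in E, (1 - potential n s ε E x)

/-- The sets `E ⊆ ℝⁿ` with `χ_E ∈ L¹(ℝⁿ)`: measurable sets of finite Lebesgue measure. The
topology is the one inherited from `MeasuredSets`, given by the extended distance
`|E ∆ F| = ‖χ_E - χ_F‖_{L¹}`. -/
abbrev IntegrableSet (n : ℕ) : Type :=
  {E : MeasuredSets (volume : Measure (EuclideanSpace ℝ (Fin n))) //
    volume (E : Set (EuclideanSpace ℝ (Fin n))) < ⊤}

/-- The underlying subset of `ℝⁿ`. -/
def IntegrableSet.toSet {n : ℕ} (E : IntegrableSet n) : Set (EuclideanSpace ℝ (Fin n)) :=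
  (E.1 : Set (EuclideanSpace ℝ (Fin n)))

/-- The functional `G^s_ε(E) = P(E) - t J^s_ε(E)`, with values in `(-∞, +∞]`. -/
def energy (n : ℕ) (s t ε : ℝ) (E : IntegrableSet n) : EReal :=
  (perimeter n E.toSet : EReal) - ((t * nonlocalEnergy n s ε E.toSet : ℝ) : EReal)

open Classical in
/-- The functional `G^s_0(E) = P(E) - t c_{n,s} P_s(E)`, which is `+∞` when `P(E) = ∞`. -/
def limitEnergy (n : ℕ) (s t : ℝ) (E : IntegrableSet n) : EReal :=
  if perimeter n E.toSet = ⊤ then ⊤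
  else (perimeter n E.toSet : EReal) -
    ((t * fracConst n s : ℝ) : EReal) * (fracPerimeter n s E.toSet : EReal)

/-- `Γ`-convergence, along the filter `l`, of the functionals `F i` to `F₀`: the `liminf`
inequality for all converging families, and the existence of recovery families. -/
def GammaConverges {ι X : Type*} [TopologicalSpace X] (l : Filter ι) (F : ι → X → EReal)
    (F₀ : X → EReal) : Prop :=
  (∀ (x : X) (u : ι → X), Tendsto u l (𝓝 x) → F₀ x ≤ liminf (fun i => F i (u i)) l) ∧
  (∀ x : X, ∃ u : ι → X, Tendsto u l (𝓝 x) ∧ limsup (fun i => F i (u i)) l ≤ F₀ x)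

end

/-! Write `K(h) = |h|^{-n-s}`, `c = c_{n,s}` and `χ = χ_E`. The potential `φ` is the variational
solution attached to the form `B(u,v) = (ε^s c/2) ∬ (u(x)-u(y)) (v(x)-v(y)) K(x-y) dx dy`. Testing
its equation with `φ` gives the energy identity `ε^s J_ε(E) = ‖χ-φ‖² + B(φ,φ)`. Testing with `χ`
gives `ε^s J_ε(E) = B(φ,χ)`, and together with the identity this yields `J_ε(E) ≤ c P_s(E)` for
every `ε` (`nonlocalEnergy_le`). In the other direction, bounded `J_ε(E)` forces `φ → χ` in `L²`,
and Fatou in the quadratic term recovers `c P_s(E)` in the limit (`eventually_lt_nonlocalEnergy`).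
The constant family is therefore a recovery family.

The bound `J_ε ≤ c P_s` makes `G_ε ≥ G_0`, so the liminf inequality is the lower semicontinuity of
`G_0`. The perimeter is lower semicontinuous. The subtracted term is controlled by interpolation
between `L¹` and `BV`: splitting the `P_s` integral at `|h| = r`, `P_s(F) - P_s(E) ≤ (P(E)+P(F))
nearMass(r) + |F ∆ E| farMass(r)` (`fracPerimeter_le_add`). As `s < 1`, `nearMass(r) → 0`. Taking `E
= ∅` and `r` small lets the perimeter absorb `t c P_s`, so large perimeters cannot lower the energy;
for bounded perimeters, `P_s` is continuous under `L¹` convergence.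

Existence of the potential is a Hilbert space projection (`exists_memLp_two_resolvent`), with values
in `[0,1]` by truncation. For uniqueness, the difference of two bounded solutions is mollified; the
result is bounded, Lipschitz and a pointwise solution of the homogeneous equation, and a maximum
principle makes it vanish (`nonpos_of_eq_integral`). -/

/-- The kernel `‖h‖^{-(n+s)}` of the fractional Laplacian. -/
noncomputable def fracKernel (n : ℕ) (s : ℝ) (h : EuclideanSpace ℝ (Fin n)) : ℝ :=
  (‖h‖ ^ ((n : ℝ) + s))⁻¹

/-- The first moment of the fractional kernel in the ball of radius `r`. -/
noncomputable def nearMass (n : ℕ) (s r : ℝ) : ℝ :=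
  ∫ h in Metric.ball (0 : EuclideanSpace ℝ (Fin n)) r, ‖h‖ * fracKernel n s h

/-- The mass of the fractional kernel outside the ball of radius `r`. -/
noncomputable def farMass (n : ℕ) (s r : ℝ) : ℝ :=
  ∫ h in (Metric.ball (0 : EuclideanSpace ℝ (Fin n)) r)ᶜ, fracKernel n s h

/-- The Gagliardo seminorm `∫∫ |u(x) - u(y)| / |x-y|^{n+s} dx dy`. -/
noncomputable def gagliardo (n : ℕ) (s : ℝ) (u : EuclideanSpace ℝ (Fin n) → ℝ) : ℝ≥0∞ :=
  ∫⁻ x, ∫⁻ y, ENNReal.ofReal (|u x - u y| * fracKernel n s (x - y))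

/-! ### Moments of the kernel and interpolation for the Gagliardo seminorm -/

section Kernel

variable {n : ℕ} {s : ℝ}

lemma fracKernel_nonneg (h : EuclideanSpace ℝ (Fin n)) : 0 ≤ fracKernel n s h := by
  unfold fracKernel; positivity

@[fun_prop]
lemma measurable_fracKernel : Measurable (fracKernel n s) := by
  unfold fracKernel; fun_prop

lemma fracKernel_neg (h : EuclideanSpace ℝ (Fin n)) : fracKernel n s (-h) = fracKernel n s h := by
  simp [fracKernel]

lemma fracKernel_sub_comm (x y : EuclideanSpace ℝ (Fin n)) :
    fracKernel n s (x - y) = fracKernel n s (y - x) := by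
  rw [← fracKernel_neg, neg_sub]

/-- The factor `‖h‖` lowers the singularity to order `n + s - 1`, which is below the dimension
because `s < 1`. -/
lemma integrableOn_ball_norm_mul_fracKernel (hn : 1 ≤ n) (hs1 : s < 1) (r : ℝ) :
    IntegrableOn (fun h => ‖h‖ * fracKernel n s h)
      (Metric.ball (0 : EuclideanSpace ℝ (Fin n)) r) := by
  refine integrableOn_ball_of_norm_le_rpow (C := 1) (α := n + s - 1) (by simpa using hn)
    (by rw [finrank_euclideanSpace_fin]; linarith) (Eventually.of_forall fun h => ?_)
    (by fun_prop)
  rcases eq_or_ne h 0 with rfl | hh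
  · simp; positivity
  · have hp : 0 < ‖h‖ := norm_pos_iff.2 hh
    rw [Real.norm_of_nonneg (mul_nonneg hp.le (fracKernel_nonneg h)), one_mul, fracKernel,
      ← Real.rpow_neg hp.le, show -((n : ℝ) + s - 1) = 1 + -((n : ℝ) + s) by ring,
      Real.rpow_add hp, Real.rpow_one]

lemma integrableOn_compl_ball_fracKernel (hs0 : 0 < s) {r : ℝ} (hr : 0 < r) :
    IntegrableOn (fracKernel n s) (Metric.ball (0 : EuclideanSpace ℝ (Fin n)) r)ᶜ := by
  -- For `‖h‖ ≥ r` one has `1 + ‖h‖ ≤ (1 + r⁻¹) ‖h‖`, which is where the constant comes from.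
  have hb : Integrable (fun h : EuclideanSpace ℝ (Fin n) =>
      ((1 + r⁻¹) ^ ((n : ℝ) + s)) * (1 + ‖h‖) ^ (-((n : ℝ) + s))) :=
    (integrable_one_add_norm (by simpa using hs0)).const_mul _
  refine Integrable.mono' hb.integrableOn (by fun_prop) ?_
  filter_upwards [ae_restrict_mem Metric.isOpen_ball.measurableSet.compl] with h hh
  have hrh : r ≤ ‖h‖ := by simpa using hh
  have hp : 0 < ‖h‖ := hr.trans_le hrh
  have hns : 0 ≤ (n : ℝ) + s := by positivity
  rw [Real.norm_of_nonneg (fracKernel_nonneg h), fracKernel, Real.rpow_neg (by positivity),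
    ← div_eq_mul_inv, ← Real.div_rpow (by positivity) (by positivity), ← Real.inv_rpow hp.le]
  refine Real.rpow_le_rpow (by positivity) ?_ hns
  rw [le_div_iff₀ (by positivity), mul_add, inv_mul_cancel₀ hp.ne', mul_one, add_comm]
  gcongr

lemma nearMass_nonneg (r : ℝ) : 0 ≤ nearMass n s r :=
  integral_nonneg fun h => mul_nonneg (norm_nonneg h) (fracKernel_nonneg h)

lemma farMass_nonneg (r : ℝ) : 0 ≤ farMass n s r :=
  integral_nonneg fun h => fracKernel_nonneg h

lemma tendsto_volume_ball (hn : 1 ≤ n) (x : EuclideanSpace ℝ (Fin n)) :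
    Tendsto (fun r : ℝ => volume (Metric.ball x r)) (𝓝[>] 0) (𝓝 0) := by
  have hn' : Nontrivial (EuclideanSpace ℝ (Fin n)) :=
    Module.nontrivial_of_finrank_pos (R := ℝ) (by rw [finrank_euclideanSpace_fin]; omega)
  have h1 : Tendsto (fun r : ℝ => ENNReal.ofReal (r ^ n) *
      volume (Metric.ball (0 : EuclideanSpace ℝ (Fin n)) 1)) (𝓝[>] 0) (𝓝 0) := by
    have : Tendsto (fun r : ℝ => ENNReal.ofReal (r ^ n)) (𝓝[>] 0) (𝓝 0) := by
      rw [← ENNReal.ofReal_zero]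
      refine (ENNReal.continuous_ofReal.tendsto 0).comp ?_
      have : Tendsto (fun r : ℝ => r ^ n) (𝓝 0) (𝓝 (0 ^ n)) := (continuous_pow n).tendsto 0
      rw [zero_pow (by omega)] at this
      exact this.mono_left nhdsWithin_le_nhds
    simpa using ENNReal.Tendsto.mul_const this (Or.inr measure_ball_lt_top.ne)
  refine h1.congr' ?_
  filter_upwards [self_mem_nhdsWithin] with r hr
  rw [Measure.addHaar_ball _ _ (le_of_lt hr)]
  simp

lemma tendsto_nearMass (hn : 1 ≤ n) (hs1 : s < 1) :
    Tendsto (nearMass n s) (𝓝[>] 0) (𝓝 0) := by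
  have hint := integrableOn_ball_norm_mul_fracKernel hn hs1 1
  have h0 : Tendsto (fun r : ℝ => (volume.restrict (Metric.ball 0 1))
      (Metric.ball (0 : EuclideanSpace ℝ (Fin n)) r)) (𝓝[>] 0) (𝓝 0) :=
    tendsto_of_tendsto_of_tendsto_of_le_of_le tendsto_const_nhds
      (tendsto_volume_ball hn 0) (fun _ => zero_le) (fun _ => Measure.restrict_apply_le _ _)
  have := hint.tendsto_setIntegral_nhds_zero h0
  refine this.congr' ?_
  filter_upwards [Ioo_mem_nhdsGT (zero_lt_one' ℝ)] with r hr
  rw [Measure.restrict_restrict Metric.isOpen_ball.measurableSet,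
    inter_eq_left.2 (Metric.ball_subset_ball hr.2.le), nearMass]

lemma lintegral_ball_norm_mul_fracKernel (hn : 1 ≤ n) (hs1 : s < 1) (r : ℝ) :
    ∫⁻ h in Metric.ball (0 : EuclideanSpace ℝ (Fin n)) r,
      ENNReal.ofReal (‖h‖ * fracKernel n s h) = ENNReal.ofReal (nearMass n s r) :=
  (ofReal_integral_eq_lintegral_ofReal (integrableOn_ball_norm_mul_fracKernel hn hs1 r)
    (Eventually.of_forall fun h => mul_nonneg (norm_nonneg h) (fracKernel_nonneg h))).symm

lemma lintegral_compl_ball_fracKernel (hs0 : 0 < s) {r : ℝ} (hr : 0 < r) :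
    ∫⁻ h in (Metric.ball (0 : EuclideanSpace ℝ (Fin n)) r)ᶜ,
      ENNReal.ofReal (fracKernel n s h) = ENNReal.ofReal (farMass n s r) :=
  (ofReal_integral_eq_lintegral_ofReal (integrableOn_compl_ball_fracKernel hs0 hr)
    (Eventually.of_forall fun h => fracKernel_nonneg h)).symm

/-- Substituting `y = x - h` and applying Tonelli turns the seminorm into the `L¹` modulus of
continuity integrated against the kernel. Every bound on the seminorm below is a bound on that
modulus. -/
lemma gagliardo_eq_lintegral_translate {u : EuclideanSpace ℝ (Fin n) → ℝ} (hu : Measurable u) :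
    gagliardo n s u =
      ∫⁻ h, ENNReal.ofReal (fracKernel n s h) * ∫⁻ x, ‖u x - u (x - h)‖ₑ := by
  have h1 (x : EuclideanSpace ℝ (Fin n)) :
      ∫⁻ y, ENNReal.ofReal (|u x - u y| * fracKernel n s (x - y)) =
        ∫⁻ h, ENNReal.ofReal (fracKernel n s h) * ‖u x - u (x - h)‖ₑ := by
    rw [← lintegral_sub_left_eq_self _ x]
    refine lintegral_congr fun h => ?_
    rw [sub_sub_cancel, mul_comm, ENNReal.ofReal_mul (fracKernel_nonneg h),
      ← Real.enorm_eq_ofReal_abs]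
  simp_rw [gagliardo, h1]
  rw [lintegral_lintegral_swap (by fun_prop)]
  refine lintegral_congr fun h => ?_
  rw [lintegral_const_mul _ (by fun_prop)]

lemma lintegral_enorm_sub_translate_le {u : EuclideanSpace ℝ (Fin n) → ℝ} (hu : Measurable u)
    (h : EuclideanSpace ℝ (Fin n)) : ∫⁻ x, ‖u x - u (x - h)‖ₑ ≤ 2 * ∫⁻ x, ‖u x‖ₑ := by
  calc ∫⁻ x, ‖u x - u (x - h)‖ₑ ≤ ∫⁻ x, (‖u x‖ₑ + ‖u (x - h)‖ₑ) :=
        lintegral_mono fun x => enorm_sub_le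
    _ = 2 * ∫⁻ x, ‖u x‖ₑ := by
        rw [lintegral_add_left (by fun_prop),
          lintegral_sub_right_eq_self (fun x => ‖u x‖ₑ) h, two_mul]

/-- Interpolation between `L¹` and `BV` for the Gagliardo seminorm. -/
lemma gagliardo_le (hn : 1 ≤ n) (hs : s ∈ Ioo (0 : ℝ) 1) {u : EuclideanSpace ℝ (Fin n) → ℝ}
    (hu : Measurable u) {M : ℝ≥0∞}
    (hM : ∀ h, ∫⁻ x, ‖u x - u (x - h)‖ₑ ≤ M * ENNReal.ofReal ‖h‖) {r : ℝ} (hr : 0 < r) :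
    gagliardo n s u ≤ M * ENNReal.ofReal (nearMass n s r) +
      2 * (∫⁻ x, ‖u x‖ₑ) * ENNReal.ofReal (farMass n s r) := by
  rw [gagliardo_eq_lintegral_translate hu,
    ← lintegral_add_compl _ (Metric.isOpen_ball (x := (0 : EuclideanSpace ℝ (Fin n)))
      (ε := r)).measurableSet]
  gcongr
  · rw [← lintegral_ball_norm_mul_fracKernel hn hs.2, ← lintegral_const_mul _ (by fun_prop)]
    refine lintegral_mono fun h => ?_
    rw [ENNReal.ofReal_mul (norm_nonneg h), ← mul_assoc, mul_comm]
    gcongr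
    exact hM h
  · rw [← lintegral_compl_ball_fracKernel hs.1 hr, ← lintegral_const_mul _ (by fun_prop)]
    refine lintegral_mono fun h => ?_
    rw [mul_comm]
    gcongr
    exact lintegral_enorm_sub_translate_le hu h

end Kernel

/-! ### The fractional Laplacian of test functions -/

section TestFunctions

variable {n : ℕ} {s : ℝ}

/-- The `L¹` modulus of continuity of a `C¹` function with compact support is linear. -/
lemma exists_lintegral_enorm_sub_translate_le {u : EuclideanSpace ℝ (Fin n) → ℝ}
    (hu : ContDiff ℝ 1 u) (hc : HasCompactSupport u) :
    ∃ M : ℝ≥0∞, M ≠ ⊤ ∧ ∀ h, ∫⁻ x, ‖u x - u (x - h)‖ₑ ≤ M * ENNReal.ofReal ‖h‖ := by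
  obtain ⟨L, hL⟩ := hu.lipschitzWith_of_hasCompactSupport hc one_ne_zero
  have hui : Integrable u := hu.continuous.integrable_of_hasCompactSupport hc
  set K := Metric.cthickening 1 (tsupport u)
  have hK : IsCompact K := IsCompact.cthickening hc
  refine ⟨L * volume K + 2 * ∫⁻ x, ‖u x‖ₑ, ?_, fun h => ?_⟩
  · exact ENNReal.add_ne_top.2 ⟨ENNReal.mul_ne_top ENNReal.coe_ne_top hK.measure_lt_top.ne,
      ENNReal.mul_ne_top (by simp) hui.2.ne⟩
  rw [add_mul]
  rcases le_or_gt ‖h‖ 1 with h1 | h1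
  · refine le_trans ?_ le_self_add
    calc ∫⁻ x, ‖u x - u (x - h)‖ₑ
        ≤ ∫⁻ x, K.indicator (fun _ => L * ENNReal.ofReal ‖h‖) x := by
          refine lintegral_mono fun x => ?_
          by_cases hx : x ∈ K
          · rw [indicator_of_mem hx]
            have := hL.edist_le_mul x (x - h)
            rwa [edist_eq_enorm_sub, edist_eq_enorm_sub, sub_sub_cancel,
              ← ofReal_norm h] at this
          · have hx1 : x ∉ tsupport u := fun hx' => hx (Metric.self_subset_cthickening _ hx')
            have hx2 : x - h ∉ tsupport u := fun hx' => hx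
              (Metric.mem_cthickening_of_dist_le x (x - h) 1 _ hx'
                (by simpa [dist_eq_norm] using h1))
            simp [image_eq_zero_of_notMem_tsupport hx1, image_eq_zero_of_notMem_tsupport hx2]
      _ = L * volume K * ENNReal.ofReal ‖h‖ := by
          rw [lintegral_indicator_const hK.measurableSet]; ring
  · refine le_trans ?_ le_add_self
    refine (lintegral_enorm_sub_translate_le hu.continuous.measurable h).trans ?_
    refine le_mul_of_one_le_right zero_le ?_
    rw [ENNReal.one_le_ofReal]; exact h1.le

lemma gagliardo_ne_top_of_translate (hn : 1 ≤ n) (hs : s ∈ Ioo (0 : ℝ) 1)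
    {u : EuclideanSpace ℝ (Fin n) → ℝ} (hu : Measurable u) (hui : ∫⁻ x, ‖u x‖ₑ ≠ ⊤) {M : ℝ≥0∞}
    (hM : M ≠ ⊤) (h : ∀ h, ∫⁻ x, ‖u x - u (x - h)‖ₑ ≤ M * ENNReal.ofReal ‖h‖) :
    gagliardo n s u ≠ ⊤ := by
  refine ne_top_of_le_ne_top ?_ (gagliardo_le hn hs hu h one_pos)
  exact ENNReal.add_ne_top.2 ⟨ENNReal.mul_ne_top hM ENNReal.ofReal_ne_top,
    ENNReal.mul_ne_top (ENNReal.mul_ne_top (by simp) hui) ENNReal.ofReal_ne_top⟩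

lemma gagliardo_ne_top_of_contDiff (hn : 1 ≤ n) (hs : s ∈ Ioo (0 : ℝ) 1)
    {u : EuclideanSpace ℝ (Fin n) → ℝ} (hu : ContDiff ℝ 1 u) (hc : HasCompactSupport u) :
    gagliardo n s u ≠ ⊤ := by
  obtain ⟨M, hM, h⟩ := exists_lintegral_enorm_sub_translate_le hu hc
  exact gagliardo_ne_top_of_translate hn hs hu.continuous.measurable
    (hu.continuous.integrable_of_hasCompactSupport hc).2.ne hM h

lemma integrable_prod_sub_mul_fracKernel {u : EuclideanSpace ℝ (Fin n) → ℝ} (hu : Measurable u)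
    (h : gagliardo n s u ≠ ⊤) :
    Integrable (fun p : EuclideanSpace ℝ (Fin n) × EuclideanSpace ℝ (Fin n) =>
      (u p.1 - u p.2) * fracKernel n s (p.1 - p.2)) (volume.prod volume) := by
  refine ⟨Measurable.aestronglyMeasurable (by fun_prop), ?_⟩
  rw [HasFiniteIntegral, lintegral_prod _ (by fun_prop)]
  refine lt_of_le_of_lt (le_of_eq ?_) h.lt_top
  refine lintegral_congr fun x => lintegral_congr fun y => ?_
  rw [Real.enorm_eq_ofReal_abs, abs_mul, abs_of_nonneg (fracKernel_nonneg _)]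

lemma integrable_prod_sub_translate_mul_fracKernel {u : EuclideanSpace ℝ (Fin n) → ℝ}
    (hu : Measurable u) (h : gagliardo n s u ≠ ⊤) :
    Integrable (fun p : EuclideanSpace ℝ (Fin n) × EuclideanSpace ℝ (Fin n) =>
      (u p.1 - u (p.1 - p.2)) * fracKernel n s p.2) (volume.prod volume) := by
  refine ⟨Measurable.aestronglyMeasurable (by fun_prop), ?_⟩
  rw [HasFiniteIntegral, lintegral_prod_symm _ (by fun_prop)]
  rw [gagliardo_eq_lintegral_translate hu] at h
  refine lt_of_le_of_lt (le_of_eq ?_) h.lt_top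
  refine lintegral_congr fun x => ?_
  rw [← lintegral_const_mul _ (by fun_prop)]
  refine lintegral_congr fun y => ?_
  rw [enorm_mul, mul_comm, Real.enorm_of_nonneg (fracKernel_nonneg _)]

lemma integrable_sub_translate_mul_fracKernel (hn : 1 ≤ n) (hs : s ∈ Ioo (0 : ℝ) 1)
    {u : EuclideanSpace ℝ (Fin n) → ℝ} {L : NNReal} (hL : LipschitzWith L u) {B : ℝ}
    (hB : ∀ x, |u x| ≤ B) (x : EuclideanSpace ℝ (Fin n)) :
    Integrable (fun h => (u x - u (x - h)) * fracKernel n s h) := by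
  have hm : Measurable u := hL.continuous.measurable
  rw [← integrableOn_univ, ← union_compl_self (Metric.ball (0 : EuclideanSpace ℝ (Fin n)) 1)]
  refine IntegrableOn.union ?_ ?_
  · refine Integrable.mono' ((integrableOn_ball_norm_mul_fracKernel hn hs.2 1).const_mul L)
      (Measurable.aestronglyMeasurable (by fun_prop)) (Eventually.of_forall fun h => ?_)
    rw [norm_mul, Real.norm_of_nonneg (fracKernel_nonneg h), ← mul_assoc]
    refine mul_le_mul_of_nonneg_right ?_ (fracKernel_nonneg h)
    simpa [dist_eq_norm] using hL.dist_le_mul x (x - h)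
  · refine Integrable.mono' ((integrableOn_compl_ball_fracKernel hs.1 one_pos).const_mul (2 * B))
      (Measurable.aestronglyMeasurable (by fun_prop)) (Eventually.of_forall fun h => ?_)
    rw [norm_mul, Real.norm_of_nonneg (fracKernel_nonneg h)]
    refine mul_le_mul_of_nonneg_right ?_ (fracKernel_nonneg h)
    have := norm_sub_le (u x) (u (x - h))
    simp only [Real.norm_eq_abs] at this ⊢
    linarith [hB x, hB (x - h)]

/-- For bounded Lipschitz functions the principal value is an absolutely convergent integral. -/
lemma fracLaplacian_eq_integral (hn : 1 ≤ n) (hs : s ∈ Ioo (0 : ℝ) 1)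
    {u : EuclideanSpace ℝ (Fin n) → ℝ} {L : NNReal} (hL : LipschitzWith L u) {B : ℝ}
    (hB : ∀ x, |u x| ≤ B) (x : EuclideanSpace ℝ (Fin n)) :
    fracLaplacian n s u x = fracConst n s * ∫ y, (u x - u y) * fracKernel n s (x - y) := by
  have hint : Integrable (fun y => (u x - u y) * fracKernel n s (x - y)) := by
    have := (integrable_sub_translate_mul_fracKernel hn hs hL hB x).comp_sub_left x
    simpa using this
  rw [fracLaplacian]
  congr 1
  refine Tendsto.limUnder_eq ?_
  -- Absolute integrability makes the part over the shrinking ball vanish, so the truncated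
  -- integrals converge to the full one.
  have h1 := hint.tendsto_setIntegral_nhds_zero (tendsto_volume_ball hn x)
  have h2 := (tendsto_const_nhds (x := ∫ y, (u x - u y) * fracKernel n s (x - y))).sub h1
  rw [sub_zero] at h2
  refine h2.congr fun r => ?_
  rw [← integral_add_compl Metric.isOpen_ball.measurableSet hint, add_sub_cancel_left]
  rfl

lemma fracLaplacian_eq_of_contDiff (hn : 1 ≤ n) (hs : s ∈ Ioo (0 : ℝ) 1)
    {u : EuclideanSpace ℝ (Fin n) → ℝ} (hu : ContDiff ℝ 1 u) (hc : HasCompactSupport u)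
    (x : EuclideanSpace ℝ (Fin n)) :
    fracLaplacian n s u x = fracConst n s * ∫ y, (u x - u y) * fracKernel n s (x - y) := by
  obtain ⟨L, hL⟩ := hu.lipschitzWith_of_hasCompactSupport hc one_ne_zero
  obtain ⟨B, hB⟩ := hu.continuous.bounded_above_of_compact_support hc
  exact fracLaplacian_eq_integral hn hs hL hB x

lemma integrable_fracLaplacian (hn : 1 ≤ n) (hs : s ∈ Ioo (0 : ℝ) 1)
    {u : EuclideanSpace ℝ (Fin n) → ℝ} (hu : ContDiff ℝ 1 u) (hc : HasCompactSupport u) :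
    Integrable (fracLaplacian n s u) := by
  rw [funext (fracLaplacian_eq_of_contDiff hn hs hu hc)]
  exact (integrable_prod_sub_mul_fracKernel hu.continuous.measurable
    (gagliardo_ne_top_of_contDiff hn hs hu hc)).integral_prod_left.const_mul _

lemma fracConst_pos (hs : s ∈ Ioo (0 : ℝ) 1) : 0 < fracConst n s := by
  -- The point `-s/2` lies strictly between `-1` and `0`, hence is not a pole.
  have h1 : Real.Gamma (-s / 2) ≠ 0 := by
    refine Real.Gamma_ne_zero fun m hm => ?_
    rcases m with _ | m
    · simp at hm; linarith [hs.1]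
    · push_cast at hm; have : (0:ℝ) ≤ m := m.cast_nonneg
      linarith [hs.2]
  have h2 : 0 < Real.Gamma (((n : ℝ) + s) / 2) :=
    Real.Gamma_pos_of_pos (div_pos (add_pos_of_nonneg_of_pos n.cast_nonneg hs.1) two_pos)
  unfold fracConst
  positivity

end TestFunctions

/-! ### Uniqueness of bounded distributional solutions -/

section Uniqueness

variable {n : ℕ} {s : ℝ}

/-- A maximum principle at infinity: a bounded Lipschitz function with
`u(x) = a ∫ (u(x-h) - u(x)) |h|^{-n-s} dh` is nonpositive. -/
lemma nonpos_of_eq_integral (hn : 1 ≤ n) (hs : s ∈ Ioo (0 : ℝ) 1)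
    {u : EuclideanSpace ℝ (Fin n) → ℝ} {L : NNReal} (hL : LipschitzWith L u) {B : ℝ}
    (hB : ∀ x, |u x| ≤ B) {a : ℝ} (ha : 0 < a)
    (h : ∀ x, u x = -(a * ∫ h, (u x - u (x - h)) * fracKernel n s h))
    (x : EuclideanSpace ℝ (Fin n)) : u x ≤ 0 := by
  have hbdd : BddAbove (range u) := ⟨B, by rintro _ ⟨y, rfl⟩; exact (abs_le.1 (hB y)).2⟩
  set S := ⨆ y, u y
  have hS (y) : u y ≤ S := le_ciSup hbdd y
  refine (hS x).trans ?_
  -- The increment `u(y-h) - u(y)` is at most `L‖h‖` inside the ball of radius `r`, and at most `S -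
  -- u(y)` outside.
  have key (r : ℝ) (hr : 0 < r) (y) :
      u y ≤ a * (L * nearMass n s r + (S - u y) * farMass n s r) := by
    refine (h y).le.trans ?_
    rw [← mul_neg]
    refine mul_le_mul_of_nonneg_left ?_ ha.le
    have hi : Integrable (fun h => -((u y - u (y - h)) * fracKernel n s h)) :=
      (integrable_sub_translate_mul_fracKernel hn hs hL hB y).neg
    rw [← integral_neg, ← integral_add_compl (Metric.isOpen_ball
      (x := (0 : EuclideanSpace ℝ (Fin n))) (ε := r)).measurableSet hi, nearMass, farMass,
      ← integral_const_mul, ← integral_const_mul]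
    refine add_le_add ?_ ?_
    · refine integral_mono hi.integrableOn
        ((integrableOn_ball_norm_mul_fracKernel hn hs.2 r).const_mul _) fun h => ?_
      simp only
      rw [← neg_mul, ← mul_assoc]
      refine mul_le_mul_of_nonneg_right ?_ (fracKernel_nonneg h)
      have := hL.dist_le_mul y (y - h)
      rw [Real.dist_eq, dist_eq_norm, sub_sub_cancel] at this
      linarith [(abs_le.1 this).1]
    · refine integral_mono hi.integrableOn
        ((integrableOn_compl_ball_fracKernel hs.1 hr).const_mul _) fun h => ?_
      simp only
      rw [← neg_mul]
      refine mul_le_mul_of_nonneg_right ?_ (fracKernel_nonneg h)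
      linarith [hS (y - h)]
  have key2 (r : ℝ) (hr : 0 < r) : S ≤ a * (L * nearMass n s r) := by
    refine le_of_forall_pos_le_add fun δ hδ => ?_
    have hD : 0 < 1 + a * farMass n s r := by
      have := farMass_nonneg (n := n) (s := s) r
      positivity
    -- The supremum need not be attained. The gap is chosen so that `S - u(y)` and the far term `a
    -- (S - u(y)) farMass(r)` together cost at most `δ`.
    obtain ⟨y, hy⟩ := exists_lt_of_lt_ciSup (sub_lt_self S (div_pos hδ hD))
    have h1 := key r hr y
    have h2 : (S - u y) * (1 + a * farMass n s r) ≤ δ := by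
      rw [← le_div_iff₀ hD]; linarith
    nlinarith
  have h0 : Tendsto (fun r => a * (L * nearMass n s r)) (𝓝[>] 0) (𝓝 (a * (L * 0))) :=
    ((tendsto_nearMass hn hs.2).const_mul _).const_mul _
  rw [mul_zero, mul_zero] at h0
  refine ge_of_tendsto h0 ?_
  filter_upwards [self_mem_nhdsWithin] with r hr using key2 r hr

/-- A bounded distributional solution of the homogeneous equation vanishes. -/
lemma ae_eq_zero_of_integral_add_fracLaplacian_eq_zero (hn : 1 ≤ n) (hs : s ∈ Ioo (0 : ℝ) 1)
    {ψ : EuclideanSpace ℝ (Fin n) → ℝ} (hψ : MemLp ψ ⊤ volume) {a : ℝ} (ha : 0 < a)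
    (h : ∀ η : EuclideanSpace ℝ (Fin n) → ℝ, ContDiff ℝ ∞ η → HasCompactSupport η →
      (∫ x, ψ x * η x) + a * ∫ x, ψ x * fracLaplacian n s η x = 0) :
    ψ =ᵐ[volume] 0 := by
  obtain ⟨B, hB0, hB⟩ : ∃ B : ℝ, 0 ≤ B ∧ ∀ᵐ x, ‖ψ x‖ ≤ B := by
    refine ⟨(eLpNormEssSup ψ volume).toReal, ENNReal.toReal_nonneg, ?_⟩
    have hfin : eLpNormEssSup ψ volume ≠ ⊤ := by simpa using hψ.2.ne
    filter_upwards [ae_le_eLpNormEssSup (f := ψ) (μ := volume)] with x hx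
    rw [← ofReal_norm] at hx
    exact (ENNReal.ofReal_le_iff_le_toReal hfin).1 hx
  have hint {η : EuclideanSpace ℝ (Fin n) → ℝ} (hη : Integrable η) :
      Integrable (fun x => ψ x * η x) := hη.bdd_mul hψ.1 hB
  have hbound {η : EuclideanSpace ℝ (Fin n) → ℝ} (hη : Integrable η) :
      |∫ x, ψ x * η x| ≤ B * ∫ x, ‖η x‖ := by
    rw [← integral_const_mul, ← Real.norm_eq_abs]
    refine norm_integral_le_of_norm_le (hη.norm.const_mul B) ?_
    filter_upwards [hB] with x hx
    rw [norm_mul]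
    gcongr
  -- the mollifications vanish
  have main (ρ : EuclideanSpace ℝ (Fin n) → ℝ) (hρ : ContDiff ℝ ∞ ρ) (hc : HasCompactSupport ρ)
      (x : EuclideanSpace ℝ (Fin n)) : ∫ y, ψ y * ρ (x - y) ≤ 0 := by
    have hρ1 : ContDiff ℝ 1 ρ := hρ.of_le (by simp)
    have hρi : Integrable ρ := hρ.continuous.integrable_of_hasCompactSupport hc
    have hρx (x) : ContDiff ℝ ∞ (fun y => ρ (x - y)) := hρ.comp (contDiff_const.sub contDiff_id)
    have hcx (x : EuclideanSpace ℝ (Fin n)) : HasCompactSupport (fun y => ρ (x - y)) :=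
      hc.comp_homeomorph (Homeomorph.subLeft x)
    obtain ⟨M, hM, hMh⟩ := exists_lintegral_enorm_sub_translate_le hρ1 hc
    have hMr (h) : ∫ y, ‖ρ y - ρ (y - h)‖ ≤ M.toReal * ‖h‖ := by
      have hm : AEStronglyMeasurable (fun y => ρ y - ρ (y - h)) volume :=
        (hρi.sub (hρi.comp_sub_right h)).aestronglyMeasurable
      rw [integral_norm_eq_lintegral_enorm hm]
      refine ENNReal.toReal_le_of_le_ofReal (by positivity) ?_
      rw [ENNReal.ofReal_mul ENNReal.toReal_nonneg, ENNReal.ofReal_toReal hM]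
      exact hMh h
    -- Mollification makes the merely bounded `ψ` Lipschitz: the linear `L¹` modulus of `ρ` is
    -- multiplied by the bound `B`.
    have hL : LipschitzWith (B * M.toReal).toNNReal (fun x => ∫ y, ψ y * ρ (x - y)) := by
      refine LipschitzWith.of_dist_le_mul fun x z => ?_
      rw [Real.coe_toNNReal _ (by positivity), Real.dist_eq,
        ← integral_sub (hint (hρi.comp_sub_left x)) (hint (hρi.comp_sub_left z)), mul_assoc]
      simp_rw [← mul_sub]
      refine (hbound ((hρi.comp_sub_left x).sub (hρi.comp_sub_left z))).trans ?_
      refine mul_le_mul_of_nonneg_left ?_ hB0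
      rw [dist_eq_norm, ← integral_sub_left_eq_self _ _ x]
      simpa [sub_sub_eq_add_sub, add_comm] using hMr (x - z)
    have hbd (x) : |∫ y, ψ y * ρ (x - y)| ≤ B * ∫ y, ‖ρ y‖ := by
      refine (hbound (hρi.comp_sub_left x)).trans (le_of_eq ?_)
      rw [integral_sub_left_eq_self (fun y => ‖ρ y‖)]
    refine nonpos_of_eq_integral hn hs hL hbd (mul_pos ha (fracConst_pos (n := n) hs))
      (fun x => ?_) x
    have hx := h _ (hρx x) (hcx x)
    have hx1 : ContDiff ℝ 1 (fun y => ρ (x - y)) := (hρx x).of_le (by simp)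
    rw [eq_neg_iff_add_eq_zero, ← hx]
    congr 1
    rw [mul_assoc]
    congr 1
    have hprod := (integrable_prod_sub_translate_mul_fracKernel (n := n) (s := s)
      hx1.continuous.measurable
      (gagliardo_ne_top_of_contDiff hn hs hx1 (hcx x))).bdd_mul (c := B) hψ.1.comp_fst
        (Measure.quasiMeasurePreserving_fst.ae hB)
    -- Translating the mollification in `x` amounts to translating the test function in `y` the
    -- opposite way. Evenness of the kernel removes the sign, and Fubini moves the operator onto the
    -- test function.
    calc fracConst n s * ∫ h, ((∫ y, ψ y * ρ (x - y)) - ∫ y, ψ y * ρ (x - h - y)) * fracKernel n s h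
        = fracConst n s * ∫ h, ∫ y, ψ y * ((ρ (x - y) - ρ (x - (y - -h))) * fracKernel n s (-h)) := by
          congr 1
          refine integral_congr_ae (Eventually.of_forall fun h => ?_)
          simp only
          rw [← integral_sub (hint (hρi.comp_sub_left x)) (hint (hρi.comp_sub_left (x - h))),
            ← integral_mul_const]
          refine integral_congr_ae (Eventually.of_forall fun y => ?_)
          simp only [fracKernel_neg, sub_neg_eq_add, sub_sub, add_comm y h]
          ring
      _ = fracConst n s * ∫ h, ∫ y, ψ y * ((ρ (x - y) - ρ (x - (y - h))) * fracKernel n s h) := by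
          rw [integral_neg_eq_self (fun h => ∫ y, ψ y *
            ((ρ (x - y) - ρ (x - (y - h))) * fracKernel n s h))]
      _ = fracConst n s * ∫ y, ∫ h, ψ y * ((ρ (x - y) - ρ (x - (y - h))) * fracKernel n s h) := by
          rw [integral_integral_swap]
          exact hprod.swap
      _ = ∫ y, ψ y * fracLaplacian n s (fun y => ρ (x - y)) y := by
          rw [← integral_const_mul]
          congr 1 with y
          rw [fracLaplacian_eq_of_contDiff hn hs hx1 (hcx x), integral_const_mul,
            ← integral_sub_left_eq_self _ _ y]
          simp only [sub_sub_cancel]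
          ring
  refine ae_eq_zero_of_integral_contDiff_smul_eq_zero (hψ.locallyIntegrable le_top)
    fun ρ hρ hc => ?_
  have hc' : HasCompactSupport (fun y => ρ (-y)) := hc.comp_homeomorph (Homeomorph.neg _)
  have h1 := main (fun y => ρ (-y)) (hρ.comp contDiff_neg) hc' 0
  have h2 := main (fun y => -ρ (-y)) (hρ.comp contDiff_neg).neg hc'.neg 0
  simp only [zero_sub, neg_neg, mul_neg, integral_neg] at h1 h2
  simp only [smul_eq_mul, mul_comm (ρ _)]
  linarith

end Uniqueness

/-! ### The resolvent of a Dirichlet form -/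

section Resolvent

variable {α : Type*} [MeasurableSpace α] {ν : Measure α} {μ : Measure (α × α)}

lemma ae_sub_eq_sub_of_ae_eq (hμ : μ ≪ ν.prod ν) {f g : α → ℝ} (h : f =ᵐ[ν] g) :
    (fun z : α × α => f z.1 - f z.2) =ᵐ[μ] fun z => g z.1 - g z.2 := by
  have h1 := hμ.ae_le (Measure.quasiMeasurePreserving_fst.ae h)
  have h2 := hμ.ae_le (Measure.quasiMeasurePreserving_snd.ae h)
  filter_upwards [h1, h2] with z hz1 hz2
  rw [hz1, hz2]

/-- The graph of `u ↦ u(x) - u(y)` in `L²(ν) × L²(μ)`. -/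
noncomputable def differenceGraph (hμ : μ ≪ ν.prod ν) :
    Submodule ℝ (WithLp 2 (Lp ℝ 2 ν × Lp ℝ 2 μ)) where
  carrier := {p | (p.snd : α × α → ℝ) =ᵐ[μ] fun z => p.fst z.1 - p.fst z.2}
  add_mem' := by
    intro p q hp hq
    have h1 := ae_sub_eq_sub_of_ae_eq hμ (Lp.coeFn_add p.fst q.fst)
    simp only [mem_ofPred_eq, WithLp.add_fst, WithLp.add_snd] at hp hq ⊢
    filter_upwards [h1, Lp.coeFn_add p.snd q.snd, hp, hq] with z hz1 hz2 hz3 hz4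
    rw [hz1, hz2, Pi.add_apply, Pi.add_apply, Pi.add_apply, hz3, hz4]
    ring
  zero_mem' := by
    have h1 := ae_sub_eq_sub_of_ae_eq hμ (Lp.coeFn_zero ℝ 2 ν)
    simp only [mem_ofPred_eq, WithLp.zero_fst, WithLp.zero_snd]
    filter_upwards [h1, Lp.coeFn_zero ℝ 2 μ] with z hz1 hz2
    rw [hz1, hz2]; simp
  smul_mem' := by
    intro c p hp
    have h1 := ae_sub_eq_sub_of_ae_eq hμ (Lp.coeFn_smul c p.fst)
    simp only [mem_ofPred_eq, WithLp.smul_fst, WithLp.smul_snd] at hp ⊢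
    filter_upwards [h1, Lp.coeFn_smul c p.snd, hp] with z hz1 hz2 hz3
    rw [hz1, hz2, Pi.smul_apply, Pi.smul_apply, Pi.smul_apply, hz3, smul_sub]

lemma mem_differenceGraph {hμ : μ ≪ ν.prod ν} {p : WithLp 2 (Lp ℝ 2 ν × Lp ℝ 2 μ)} :
    p ∈ differenceGraph hμ ↔
      (p.snd : α × α → ℝ) =ᵐ[μ] fun z => p.fst z.1 - p.fst z.2 := Iff.rfl

/-- Along a common subsequence both components converge almost everywhere, and `μ ≪ ν ⊗ ν` carries
the convergence of the first to `μ`-almost every pair, so the pointwise relation survives. -/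
lemma isClosed_differenceGraph (hμ : μ ≪ ν.prod ν) :
    IsClosed (differenceGraph hμ : Set (WithLp 2 (Lp ℝ 2 ν × Lp ℝ 2 μ))) := by
  refine IsSeqClosed.isClosed fun p q hp hq => ?_
  have h1 : Tendsto (fun k => (p k).fst) atTop (𝓝 q.fst) :=
    ((WithLp.continuous_fst 2 _ _).tendsto q).comp hq
  have h2 : Tendsto (fun k => (p k).snd) atTop (𝓝 q.snd) :=
    ((WithLp.continuous_snd 2 _ _).tendsto q).comp hq
  obtain ⟨k1, hk1, hk1'⟩ := (tendstoInMeasure_of_tendsto_Lp h1).exists_seq_tendsto_ae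
  obtain ⟨k2, hk2, hk2'⟩ := (tendstoInMeasure_of_tendsto_Lp
    (h2.comp hk1.tendsto_atTop)).exists_seq_tendsto_ae
  have h3 := hμ.ae_le (Measure.quasiMeasurePreserving_fst.ae hk1')
  have h4 := hμ.ae_le (Measure.quasiMeasurePreserving_snd.ae hk1')
  have h5 : ∀ᵐ z ∂μ, ∀ k, (p k).snd z = (p k).fst z.1 - (p k).fst z.2 :=
    ae_all_iff.2 fun k => hp k
  filter_upwards [h3, h4, h5, hk2'] with z hz1 hz2 hz3 hz4
  refine tendsto_nhds_unique hz4 ?_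
  simp only [Function.comp_apply, hz3]
  exact (hz1.comp hk2.tendsto_atTop).sub (hz2.comp hk2.tendsto_atTop)

/-- The variational solution of `u + A u = f`, where `A` is the operator associated with the
Dirichlet form `∫ (u(x) - u(y)) (v(x) - v(y)) dμ`. -/
lemma exists_memLp_two_resolvent (hμ : μ ≪ ν.prod ν) {f : α → ℝ} (hf : MemLp f 2 ν) :
    ∃ φ : α → ℝ, Measurable φ ∧ MemLp φ 2 ν ∧ MemLp (fun z : α × α => φ z.1 - φ z.2) 2 μ ∧
      ∀ η : α → ℝ, MemLp η 2 ν → MemLp (fun z : α × α => η z.1 - η z.2) 2 μ →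
        ∫ x, φ x * η x ∂ν + ∫ z, (φ z.1 - φ z.2) * (η z.1 - η z.2) ∂μ = ∫ x, f x * η x ∂ν := by
  have : CompleteSpace (differenceGraph hμ) := (isClosed_differenceGraph hμ).completeSpace_coe
  -- Minimising `‖u - f‖² + ‖du‖²`, with `du(x,y) = u(x) - u(y)`, means projecting `(f, 0)` onto the
  -- graph of `d`; orthogonality of the residual is the weak equation.
  set v : WithLp 2 (Lp ℝ 2 ν × Lp ℝ 2 μ) := WithLp.toLp 2 (hf.toLp f, 0)
  set p := (differenceGraph hμ).starProjection v
  have hp : p ∈ differenceGraph hμ := Submodule.starProjection_apply_mem _ v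
  have hp' := mem_differenceGraph.1 hp
  refine ⟨p.fst, (Lp.stronglyMeasurable p.fst).measurable, Lp.memLp p.fst,
    (memLp_congr_ae hp').1 (Lp.memLp p.snd), fun η hη hη' => ?_⟩
  set q : WithLp 2 (Lp ℝ 2 ν × Lp ℝ 2 μ) := WithLp.toLp 2 (hη.toLp η, hη'.toLp _)
  have hq : q ∈ differenceGraph hμ := by
    rw [mem_differenceGraph]
    filter_upwards [hη'.coeFn_toLp, ae_sub_eq_sub_of_ae_eq hμ hη.coeFn_toLp] with z hz1 hz2
    simp only [q, WithLp.toLp_fst, WithLp.toLp_snd]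
    rw [hz1, hz2]
  have horth := Submodule.starProjection_inner_eq_zero v q hq
  rw [inner_sub_left, sub_eq_zero] at horth
  simp only [WithLp.prod_inner_apply, L2.inner_def] at horth
  have e1 : ∫ a, inner ℝ ((v.ofLp.1 : α → ℝ) a) ((q.ofLp.1 : α → ℝ) a) ∂ν = ∫ x, f x * η x ∂ν := by
    refine integral_congr_ae ?_
    filter_upwards [hf.coeFn_toLp, hη.coeFn_toLp] with x h1 h2
    simp only [v, q, h1, h2, RCLike.inner_apply, conj_trivial, mul_comm]
  have e2 : ∫ a, inner ℝ ((v.ofLp.2 : α × α → ℝ) a) ((q.ofLp.2 : α × α → ℝ) a) ∂μ = 0 := by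
    refine integral_eq_zero_of_ae ?_
    filter_upwards [Lp.coeFn_zero ℝ 2 μ] with z h1
    simp only [v]
    rw [h1]
    simp
  have e3 : ∫ a, inner ℝ ((p.ofLp.1 : α → ℝ) a) ((q.ofLp.1 : α → ℝ) a) ∂ν =
      ∫ x, p.fst x * η x ∂ν := by
    refine integral_congr_ae ?_
    filter_upwards [hη.coeFn_toLp] with x h2
    simp only [q, h2, RCLike.inner_apply, conj_trivial, mul_comm, WithLp.ofLp_fst]
  have e4 : ∫ a, inner ℝ ((p.ofLp.2 : α × α → ℝ) a) ((q.ofLp.2 : α × α → ℝ) a) ∂μ =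
      ∫ z, (p.fst z.1 - p.fst z.2) * (η z.1 - η z.2) ∂μ := by
    refine integral_congr_ae ?_
    filter_upwards [hη'.coeFn_toLp, hp'] with z h1 h2
    rw [WithLp.ofLp_snd, h2]
    simp only [q, h1, RCLike.inner_apply, conj_trivial, mul_comm]
  rw [← e1, ← e3, ← e4, ← horth, e2, add_zero]

/-- The excess of `a` over its truncation to `[0,1]` is a nondecreasing contraction of `a`. This
makes it an admissible test function on which the form is nonnegative; the last inequality bounds
its square when it is tested against `a - f`. -/
lemma clamp_estimates (a b f : ℝ) (hf : f ∈ Icc (0 : ℝ) 1) :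
    |a - max 0 (min 1 a)| ≤ |a| ∧
    |(a - max 0 (min 1 a)) - (b - max 0 (min 1 b))| ≤ |a - b| ∧
    0 ≤ (a - b) * ((a - max 0 (min 1 a)) - (b - max 0 (min 1 b))) ∧
    (a - max 0 (min 1 a)) ^ 2 ≤ (a - f) * (a - max 0 (min 1 a)) := by
  obtain ⟨hf0, hf1⟩ := hf
  rcases le_total a 0 with ha | ha <;> rcases le_total a 1 with ha' | ha' <;>
  rcases le_total b 0 with hb | hb <;> rcases le_total b 1 with hb' | hb' <;>
  simp only [ha, ha', hb, hb', min_eq_left, min_eq_right, max_eq_left, max_eq_right,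
    zero_le_one] <;>
  refine ⟨sq_le_sq.1 ?_, sq_le_sq.1 ?_, ?_, ?_⟩ <;>
  nlinarith [sq_nonneg (a - b)]

/-- The variational solution of `u + A u = f` satisfies `0 ≤ u ≤ 1` when `0 ≤ f ≤ 1`. -/
lemma exists_resolvent_mem_Icc (hμ : μ ≪ ν.prod ν) {f : α → ℝ} (hf : MemLp f 2 ν)
    (hf01 : ∀ x, f x ∈ Icc (0 : ℝ) 1) :
    ∃ φ : α → ℝ, Measurable φ ∧ (∀ x, φ x ∈ Icc (0 : ℝ) 1) ∧ MemLp φ 2 ν ∧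
      MemLp (fun z : α × α => φ z.1 - φ z.2) 2 μ ∧
      ∀ η : α → ℝ, MemLp η 2 ν → MemLp (fun z : α × α => η z.1 - η z.2) 2 μ →
        ∫ x, φ x * η x ∂ν + ∫ z, (φ z.1 - φ z.2) * (η z.1 - η z.2) ∂μ = ∫ x, f x * η x ∂ν := by
  obtain ⟨φ, hm, h2, hd, hw⟩ := exists_memLp_two_resolvent hμ hf
  set T : α → ℝ := fun x => max 0 (min 1 (φ x)) with hT
  have hTm : Measurable T := by fun_prop
  -- Testing with the excess gives `∫ η² ≤ ∫ (φ - f) η ≤ 0`, since the form term is nonnegative.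
  set η : α → ℝ := fun x => φ x - T x with hη
  have hη2 : MemLp η 2 ν := h2.mono (hm.sub hTm).aestronglyMeasurable
    (Eventually.of_forall fun x => (clamp_estimates (φ x) 0 0 (by simp)).1)
  have hηd : MemLp (fun z : α × α => η z.1 - η z.2) 2 μ :=
    hd.mono (by fun_prop)
      (Eventually.of_forall fun z => (clamp_estimates (φ z.1) (φ z.2) 0 (by simp)).2.1)
  have h0 : φ =ᵐ[ν] T := by
    have hw1 := hw η hη2 hηd
    have hi1 : Integrable (fun x => φ x * η x) ν := h2.integrable_mul hη2
    have hi2 : Integrable (fun x => f x * η x) ν := hf.integrable_mul hη2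
    have hpos : 0 ≤ ∫ z, (φ z.1 - φ z.2) * (η z.1 - η z.2) ∂μ :=
      integral_nonneg fun z => (clamp_estimates (φ z.1) (φ z.2) 0 (by simp)).2.2.1
    have hle : ∫ x, η x ^ 2 ∂ν ≤ ∫ x, (φ x * η x - f x * η x) ∂ν := by
      refine integral_mono hη2.integrable_sq (hi1.sub hi2) fun x => ?_
      simp only [← sub_mul]
      exact (clamp_estimates (φ x) 0 (f x) (hf01 x)).2.2.2
    rw [integral_sub hi1 hi2] at hle
    have hz : ∫ x, η x ^ 2 ∂ν = 0 :=
      le_antisymm (by linarith) (integral_nonneg fun x => sq_nonneg _)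
    rw [integral_eq_zero_iff_of_nonneg (fun x => sq_nonneg _) hη2.integrable_sq] at hz
    filter_upwards [hz] with x hx
    simpa [hη, sub_eq_zero] using hx
  have h0' := ae_sub_eq_sub_of_ae_eq hμ h0
  refine ⟨T, hTm, fun x => ⟨le_max_left _ _, max_le zero_le_one (min_le_left _ _)⟩,
    (memLp_congr_ae h0).1 h2, (memLp_congr_ae h0').1 hd, fun ζ hζ hζ' => ?_⟩
  rw [← hw ζ hζ hζ']
  congr 1
  · refine integral_congr_ae ?_
    filter_upwards [h0] with x hx using by rw [hx]
  · refine integral_congr_ae ?_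
    filter_upwards [h0'] with x hx using by rw [hx]

end Resolvent

/-! ### Existence of the potential and its energy identity -/

/-- The measure `κ |x-y|^{-n-s} dx dy`. -/
noncomputable def jumpMeasure (n : ℕ) (s κ : ℝ) :
    Measure (EuclideanSpace ℝ (Fin n) × EuclideanSpace ℝ (Fin n)) :=
  (volume.prod volume).withDensity fun p => ENNReal.ofReal (κ * fracKernel n s (p.1 - p.2))

section Potential

variable {n : ℕ} {s : ℝ}

lemma jumpMeasure_absolutelyContinuous (κ : ℝ) :
    jumpMeasure n s κ ≪ volume.prod volume := withDensity_absolutelyContinuous _ _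

lemma integral_jumpMeasure {κ : ℝ} (hκ : 0 ≤ κ)
    (g : EuclideanSpace ℝ (Fin n) × EuclideanSpace ℝ (Fin n) → ℝ) :
    ∫ z, g z ∂jumpMeasure n s κ =
      κ * ∫ z, g z * fracKernel n s (z.1 - z.2) ∂(volume.prod volume) := by
  rw [jumpMeasure, integral_withDensity_eq_integral_toReal_smul (by fun_prop) (by simp),
    ← integral_const_mul]
  refine integral_congr_ae (Eventually.of_forall fun z => ?_)
  simp only [smul_eq_mul]
  rw [ENNReal.toReal_ofReal (mul_nonneg hκ (fracKernel_nonneg _))]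
  ring

lemma lintegral_jumpMeasure {κ : ℝ} (hκ : 0 ≤ κ)
    {g : EuclideanSpace ℝ (Fin n) × EuclideanSpace ℝ (Fin n) → ℝ} (hg : Measurable g)
    (hg0 : ∀ z, 0 ≤ g z) :
    ∫⁻ z, ENNReal.ofReal (g z) ∂jumpMeasure n s κ = ENNReal.ofReal κ *
      ∫⁻ z, ENNReal.ofReal (g z * fracKernel n s (z.1 - z.2)) ∂(volume.prod volume) := by
  rw [jumpMeasure, lintegral_withDensity_eq_lintegral_mul _ (by fun_prop) (by fun_prop),
    ← lintegral_const_mul _ (by fun_prop)]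
  refine lintegral_congr fun z => ?_
  rw [Pi.mul_apply, ENNReal.ofReal_mul hκ, ENNReal.ofReal_mul (hg0 z)]
  ring

lemma memLp_two_jumpMeasure {κ : ℝ} (hκ : 0 ≤ κ) {u : EuclideanSpace ℝ (Fin n) → ℝ}
    (hu : Measurable u) {B : ℝ} (hB : ∀ x, |u x| ≤ B) (hg : gagliardo n s u ≠ ⊤) :
    MemLp (fun z : EuclideanSpace ℝ (Fin n) × EuclideanSpace ℝ (Fin n) => u z.1 - u z.2) 2
      (jumpMeasure n s κ) := by
  rw [memLp_two_iff_integrable_sq (by fun_prop), jumpMeasure,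
    integrable_withDensity_iff_integrable_smul' (by fun_prop) (by simp)]
  have h1 := ((integrable_prod_sub_mul_fracKernel hu hg).bdd_mul (c := 2 * B)
    (f := fun z => u z.1 - u z.2) (by fun_prop) (Eventually.of_forall fun z => by
      have := norm_sub_le (u z.1) (u z.2)
      simp only [Real.norm_eq_abs] at this ⊢
      linarith [hB z.1, hB z.2])).const_mul κ
  refine h1.congr (Eventually.of_forall fun z => ?_)
  simp only [smul_eq_mul]
  rw [ENNReal.toReal_ofReal (mul_nonneg hκ (fracKernel_nonneg _))]
  ring

/-- `(η(x) - η(y)) K(x-y)` is antisymmetric, so the `φ(x)` and `φ(y)` contributions coincide and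
give the factor 2. Since `η` has finite Gagliardo seminorm, boundedness of `φ` suffices for Fubini.
This identifies the weak equation with the distributional one. -/
lemma integral_sub_mul_sub_jumpMeasure (hn : 1 ≤ n) (hs : s ∈ Ioo (0 : ℝ) 1) {κ : ℝ} (hκ : 0 ≤ κ)
    {φ η : EuclideanSpace ℝ (Fin n) → ℝ} (hφ : Measurable φ) {B : ℝ} (hB : ∀ x, |φ x| ≤ B)
    (hη : ContDiff ℝ 1 η) (hc : HasCompactSupport η) :
    fracConst n s * ∫ z, (φ z.1 - φ z.2) * (η z.1 - η z.2) ∂jumpMeasure n s κ =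
      2 * κ * ∫ x, φ x * fracLaplacian n s η x := by
  have hint := integrable_prod_sub_mul_fracKernel hη.continuous.measurable
    (gagliardo_ne_top_of_contDiff hn hs hη hc)
  have h1 := hint.bdd_mul (c := B) (f := fun z => φ z.1)
    (hφ.comp measurable_fst).aestronglyMeasurable
    (Eventually.of_forall fun z => hB z.1)
  have h2 := hint.bdd_mul (c := B) (f := fun z => φ z.2)
    (hφ.comp measurable_snd).aestronglyMeasurable
    (Eventually.of_forall fun z => hB z.2)
  have hswap : ∫ z : EuclideanSpace ℝ (Fin n) × EuclideanSpace ℝ (Fin n),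
      φ z.2 * ((η z.1 - η z.2) * fracKernel n s (z.1 - z.2)) ∂(volume.prod volume) =
      -∫ z : EuclideanSpace ℝ (Fin n) × EuclideanSpace ℝ (Fin n),
      φ z.1 * ((η z.1 - η z.2) * fracKernel n s (z.1 - z.2)) ∂(volume.prod volume) := by
    rw [← integral_prod_swap, ← integral_neg]
    refine integral_congr_ae (Eventually.of_forall fun z => ?_)
    simp only [Prod.fst_swap, Prod.snd_swap]
    rw [fracKernel_sub_comm]
    ring
  have hfub : fracConst n s * ∫ z : EuclideanSpace ℝ (Fin n) × EuclideanSpace ℝ (Fin n),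
      φ z.1 * ((η z.1 - η z.2) * fracKernel n s (z.1 - z.2)) ∂(volume.prod volume) =
      ∫ x, φ x * fracLaplacian n s η x := by
    rw [integral_prod _ h1, ← integral_const_mul]
    refine integral_congr_ae (Eventually.of_forall fun x => ?_)
    simp only
    rw [integral_const_mul, fracLaplacian_eq_of_contDiff hn hs hη hc]
    ring
  rw [integral_jumpMeasure hκ, ← hfub]
  have : ∫ z : EuclideanSpace ℝ (Fin n) × EuclideanSpace ℝ (Fin n),
      (φ z.1 - φ z.2) * (η z.1 - η z.2) * fracKernel n s (z.1 - z.2) ∂(volume.prod volume) =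
      2 * ∫ z : EuclideanSpace ℝ (Fin n) × EuclideanSpace ℝ (Fin n),
      φ z.1 * ((η z.1 - η z.2) * fracKernel n s (z.1 - z.2)) ∂(volume.prod volume) := by
    rw [two_mul]
    nth_rewrite 2 [← neg_neg (∫ z : EuclideanSpace ℝ (Fin n) × EuclideanSpace ℝ (Fin n),
      φ z.1 * ((η z.1 - η z.2) * fracKernel n s (z.1 - z.2)) ∂(volume.prod volume))]
    rw [← hswap, ← sub_eq_add_neg, ← integral_sub h1 h2]
    refine integral_congr_ae (Eventually.of_forall fun z => ?_)
    simp only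
    ring
  rw [this]
  ring

lemma IsBoundedSolution.ae_eq (hn : 1 ≤ n) (hs : s ∈ Ioo (0 : ℝ) 1) {ε : ℝ} (hε : 0 < ε)
    {E : Set (EuclideanSpace ℝ (Fin n))} {φ ψ : EuclideanSpace ℝ (Fin n) → ℝ}
    (hφ : IsBoundedSolution n s ε E φ) (hψ : IsBoundedSolution n s ε E ψ) : ψ =ᵐ[volume] φ := by
  have h := ae_eq_zero_of_integral_add_fracLaplacian_eq_zero hn hs (hψ.1.sub hφ.1)
    (Real.rpow_pos_of_pos hε s) fun η hη hc => ?_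
  · filter_upwards [h] with x hx
    simpa [sub_eq_zero] using hx
  · have hη1 : ContDiff ℝ 1 η := hη.of_le (by simp)
    have i1 : Integrable η := hη.continuous.integrable_of_hasCompactSupport hc
    have i2 := integrable_fracLaplacian hn hs hη1 hc
    have e1 := hφ.2 η hη hc
    have e2 := hψ.2 η hη hc
    have hi {ζ θ : EuclideanSpace ℝ (Fin n) → ℝ} (hζ : MemLp ζ ⊤ volume) (hθ : Integrable θ) :
        Integrable (fun x => ζ x * θ x) := hθ.mul_of_top_right hζ
    simp only [Pi.sub_apply, sub_mul]
    rw [integral_sub (hi hψ.1 i1) (hi hφ.1 i1), integral_sub (hi hψ.1 i2) (hi hφ.1 i2)]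
    linarith

lemma fracPerimeter_eq_gagliardo (E : Set (EuclideanSpace ℝ (Fin n))) :
    fracPerimeter n s E = 2⁻¹ * gagliardo n s (E.indicator fun _ => 1) := rfl

lemma abs_indicator_one_le (E : Set (EuclideanSpace ℝ (Fin n))) (x : EuclideanSpace ℝ (Fin n)) :
    |E.indicator (fun _ => (1 : ℝ)) x| ≤ 1 := by
  by_cases hx : x ∈ E <;> simp [hx]

/-- Differences of an indicator lie in `{-1, 0, 1}`, so square and modulus agree; this is how a
quadratic energy produces the `s`-perimeter. -/
lemma lintegral_sq_indicator_eq_gagliardo {E : Set (EuclideanSpace ℝ (Fin n))}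
    (hE : MeasurableSet E) :
    ∫⁻ z : EuclideanSpace ℝ (Fin n) × EuclideanSpace ℝ (Fin n), ENNReal.ofReal
      ((E.indicator (fun _ => (1 : ℝ)) z.1 - E.indicator (fun _ => (1 : ℝ)) z.2) ^ 2 *
        fracKernel n s (z.1 - z.2)) ∂(volume.prod volume) =
      gagliardo n s (E.indicator fun _ => 1) := by
  have hm : Measurable (E.indicator fun _ => (1 : ℝ)) := measurable_const.indicator hE
  rw [lintegral_prod _ (by fun_prop)]
  refine lintegral_congr fun x => lintegral_congr fun y => ?_
  congr 2
  by_cases hx : x ∈ E <;> by_cases hy : y ∈ E <;> simp [hx, hy]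

/-- The potential exists, takes values in `[0,1]`, and carries the variational energy. -/
lemma exists_isBoundedSolution (hn : 1 ≤ n) (hs : s ∈ Ioo (0 : ℝ) 1) {ε : ℝ} (hε : 0 < ε)
    {E : Set (EuclideanSpace ℝ (Fin n))} (hE : MeasurableSet E) (hfin : volume E ≠ ⊤) :
    ∃ φ : EuclideanSpace ℝ (Fin n) → ℝ, Measurable φ ∧ IsBoundedSolution n s ε E φ ∧
      0 ≤ ∫ x in E, (1 - φ x) ∧
      ENNReal.ofReal (∫ x in E, (1 - φ x)) =
        (∫⁻ x, ENNReal.ofReal ((E.indicator (fun _ => 1) x - φ x) ^ 2)) +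
        ENNReal.ofReal (ε ^ s * fracConst n s / 2) *
          ∫⁻ z : EuclideanSpace ℝ (Fin n) × EuclideanSpace ℝ (Fin n),
            ENNReal.ofReal ((φ z.1 - φ z.2) ^ 2 * fracKernel n s (z.1 - z.2))
              ∂(volume.prod volume) ∧
      (fracPerimeter n s E ≠ ⊤ →
        ∫ x in E, (1 - φ x) ≤ ε ^ s * fracConst n s * (fracPerimeter n s E).toReal) := by
  set χ : EuclideanSpace ℝ (Fin n) → ℝ := E.indicator fun _ => 1 with hχ
  have hχm : Measurable χ := measurable_const.indicator hE
  have hχ2 : MemLp χ 2 volume := memLp_indicator_const 2 hE 1 (Or.inr hfin)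
  -- The half compensates for each pair of points being counted twice in the form.
  set κ := ε ^ s * fracConst n s / 2 with hκdef
  have hc := fracConst_pos (n := n) hs
  have hεs := Real.rpow_pos_of_pos hε s
  have hκ : 0 < κ := by positivity
  obtain ⟨φ, hm, h01, h2, hd, hw⟩ := exists_resolvent_mem_Icc
    (jumpMeasure_absolutelyContinuous (n := n) (s := s) κ) hχ2 (fun x => by
      by_cases hx : x ∈ E <;> simp [hχ, hx])
  have hB (x) : |φ x| ≤ 1 := by rw [abs_of_nonneg (h01 x).1]; exact (h01 x).2
  have hEint (η : EuclideanSpace ℝ (Fin n) → ℝ) : ∫ x, χ x * η x = ∫ x in E, η x := by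
    rw [← integral_indicator hE]
    refine integral_congr_ae (Eventually.of_forall fun x => ?_)
    by_cases hx : x ∈ E <;> simp [hχ, hx]
  have hφE : IntegrableOn φ E := Integrable.mono' (g := fun _ => (1 : ℝ))
    (integrableOn_const hfin) hm.aestronglyMeasurable (Eventually.of_forall hB)
  have hJ : ∫ x in E, (1 - φ x) = (∫ x, χ x * χ x) - ∫ x, χ x * φ x := by
    have h1E : IntegrableOn (fun _ : EuclideanSpace ℝ (Fin n) => (1 : ℝ)) E :=
      integrableOn_const hfin
    rw [integral_sub h1E hφE, hEint, hEint]
    congr 1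
    refine setIntegral_congr_fun hE fun x hx => ?_
    simp [hχ, hx]
  have hwφ := hw φ h2 hd
  have hiχφ : Integrable (fun x => χ x * φ x) := hχ2.integrable_mul h2
  have hiχχ : Integrable (fun x => χ x * χ x) := hχ2.integrable_mul hχ2
  have hiφφ : Integrable (fun x => φ x * φ x) := h2.integrable_mul h2
  have hsq : ∫ x, (χ x - φ x) ^ 2 =
      (∫ x, χ x * χ x) - 2 * (∫ x, χ x * φ x) + ∫ x, φ x * φ x := by
    have hi3 : Integrable (fun x => χ x * χ x - 2 * (χ x * φ x)) := hiχχ.sub (hiχφ.const_mul 2)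
    rw [← integral_const_mul, ← integral_sub hiχχ (hiχφ.const_mul 2), ← integral_add hi3 hiφφ]
    refine integral_congr_ae (Eventually.of_forall fun x => ?_)
    simp only
    ring
  have hEn : ∫ x in E, (1 - φ x) = (∫ x, (χ x - φ x) ^ 2) +
      ∫ z, (φ z.1 - φ z.2) * (φ z.1 - φ z.2) ∂jumpMeasure n s κ := by
    rw [hJ, hsq]; linarith
  refine ⟨φ, hm, ⟨memLp_top_of_bound hm.aestronglyMeasurable 1 (Eventually.of_forall hB),
    fun η hη hcη => ?_⟩, ?_, ?_, fun hP => ?_⟩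
  · have hη1 : ContDiff ℝ 1 η := hη.of_le (by simp)
    obtain ⟨Bη, hBη⟩ := hη.continuous.bounded_above_of_compact_support hcη
    have h3 := hw η (hη.continuous.memLp_of_hasCompactSupport hcη)
      (memLp_two_jumpMeasure hκ.le hη.continuous.measurable hBη
        (gagliardo_ne_top_of_contDiff hn hs hη1 hcη))
    have h4 := integral_sub_mul_sub_jumpMeasure hn hs hκ.le hm hB hη1 hcη
    rw [← hEint, ← h3]
    congr 1
    have : fracConst n s * (ε ^ s * ∫ x, φ x * fracLaplacian n s η x) =
      fracConst n s * ∫ z, (φ z.1 - φ z.2) * (η z.1 - η z.2) ∂jumpMeasure n s κ := by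
      rw [h4, hκdef]; ring
    exact mul_left_cancel₀ hc.ne' this
  · rw [hEn]
    exact add_nonneg (integral_nonneg fun x => sq_nonneg _)
      (integral_nonneg fun z => mul_self_nonneg _)
  · have hi := hd.integrable_sq
    have hi' : Integrable (fun x => (χ x - φ x) ^ 2) := (hχ2.sub h2).integrable_sq
    simp_rw [← pow_two] at hEn
    rw [hEn, ENNReal.ofReal_add (integral_nonneg fun x => sq_nonneg _)
      (integral_nonneg fun x => sq_nonneg _),
      ofReal_integral_eq_lintegral_ofReal hi' (Eventually.of_forall fun x => sq_nonneg _),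
      ofReal_integral_eq_lintegral_ofReal hi (Eventually.of_forall fun x => sq_nonneg _),
      lintegral_jumpMeasure hκ.le (by fun_prop) fun z => sq_nonneg _]
  · have hG : gagliardo n s χ ≠ ⊤ := by
      intro h
      rw [fracPerimeter_eq_gagliardo, ← hχ, h] at hP
      simp at hP
    have hχd := memLp_two_jumpMeasure (κ := κ) hκ.le hχm (abs_indicator_one_le E) hG
    have hwχ := hw χ hχ2 hχd
    have hQ : ∫ z, (χ z.1 - χ z.2) ^ 2 ∂jumpMeasure n s κ =
        ε ^ s * fracConst n s * (fracPerimeter n s E).toReal := by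
      rw [integral_eq_lintegral_of_nonneg_ae (Eventually.of_forall fun z => sq_nonneg _)
        (by fun_prop), lintegral_jumpMeasure hκ.le (by fun_prop) fun z => sq_nonneg _,
        lintegral_sq_indicator_eq_gagliardo hE, fracPerimeter_eq_gagliardo, ENNReal.toReal_mul,
        ENNReal.toReal_mul, ENNReal.toReal_ofReal hκ.le, hκdef]
      simp
      ring
    rw [← hQ]
    have hφφ : Integrable (fun z : EuclideanSpace ℝ (Fin n) × EuclideanSpace ℝ (Fin n) =>
      (φ z.1 - φ z.2) * (φ z.1 - φ z.2)) (jumpMeasure n s κ) := hd.integrable_mul hd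
    -- Testing with `χ` gives `∫_E (1-φ) = B(φ,χ) ≤ B(φ,φ)/2 + B(χ,χ)/2`. The energy identity bounds
    -- `B(φ,φ)` by the left side, so half of it is absorbed.
    have hcs : ∫ z, (φ z.1 - φ z.2) * (χ z.1 - χ z.2) ∂jumpMeasure n s κ ≤
        ∫ z, (2⁻¹ * ((φ z.1 - φ z.2) * (φ z.1 - φ z.2)) + 2⁻¹ * (χ z.1 - χ z.2) ^ 2)
          ∂jumpMeasure n s κ := by
      refine integral_mono (hd.integrable_mul hχd) ((hφφ.const_mul _).add
        (hχd.integrable_sq.const_mul _)) fun z => ?_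
      simp only
      nlinarith [sq_nonneg ((φ z.1 - φ z.2) - (χ z.1 - χ z.2))]
    rw [integral_add (hφφ.const_mul _) (hχd.integrable_sq.const_mul _),
      integral_const_mul, integral_const_mul] at hcs
    have hpos : 0 ≤ ∫ x, (χ x - φ x) ^ 2 := integral_nonneg fun x => sq_nonneg _
    have hcomm : ∫ x, φ x * χ x = ∫ x, χ x * φ x := by simp_rw [mul_comm]
    rw [hcomm] at hwχ
    linarith

end Potential

/-! ### Upper bound and limit of the nonlocal energy on a fixed set -/

section Energy

variable {n : ℕ} {s : ℝ}

/-- `potential` is an arbitrary choice; uniqueness allows it to be replaced by the variational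
solution. -/
lemma potential_ae_eq (hn : 1 ≤ n) (hs : s ∈ Ioo (0 : ℝ) 1) {ε : ℝ} (hε : 0 < ε)
    {E : Set (EuclideanSpace ℝ (Fin n))} {φ : EuclideanSpace ℝ (Fin n) → ℝ}
    (hφ : IsBoundedSolution n s ε E φ) : potential n s ε E =ᵐ[volume] φ := by
  have hex : ∃ φ, IsBoundedSolution n s ε E φ := ⟨φ, hφ⟩
  rw [potential, dif_pos hex]
  exact hφ.ae_eq hn hs hε hex.choose_spec

lemma nonlocalEnergy_eq (hn : 1 ≤ n) (hs : s ∈ Ioo (0 : ℝ) 1) {ε : ℝ} (hε : 0 < ε)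
    {E : Set (EuclideanSpace ℝ (Fin n))} {φ : EuclideanSpace ℝ (Fin n) → ℝ}
    (hφ : IsBoundedSolution n s ε E φ) :
    ε ^ s * nonlocalEnergy n s ε E = ∫ x in E, (1 - φ x) := by
  rw [nonlocalEnergy, ← mul_assoc, ← Real.rpow_add hε, add_neg_cancel, Real.rpow_zero, one_mul]
  refine integral_congr_ae (ae_restrict_of_ae ?_)
  filter_upwards [potential_ae_eq hn hs hε hφ] with x hx
  rw [hx]

lemma nonlocalEnergy_le (hn : 1 ≤ n) (hs : s ∈ Ioo (0 : ℝ) 1) {ε : ℝ} (hε : 0 < ε)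
    {E : Set (EuclideanSpace ℝ (Fin n))} (hE : MeasurableSet E) (hfin : volume E ≠ ⊤)
    (hP : fracPerimeter n s E ≠ ⊤) :
    nonlocalEnergy n s ε E ≤ fracConst n s * (fracPerimeter n s E).toReal := by
  obtain ⟨φ, -, hφ, -, -, h⟩ := exists_isBoundedSolution hn hs hε hE hfin
  have h1 := h hP
  rw [← nonlocalEnergy_eq hn hs hε hφ, mul_assoc] at h1
  exact le_of_mul_le_mul_left h1 (Real.rpow_pos_of_pos hε s)

lemma eventually_lt_nonlocalEnergy (hn : 1 ≤ n) (hs : s ∈ Ioo (0 : ℝ) 1)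
    {E : Set (EuclideanSpace ℝ (Fin n))} (hE : MeasurableSet E) (hfin : volume E ≠ ⊤)
    {b : ℝ}
    (hb : b < fracConst n s * (fracPerimeter n s E).toReal) :
    ∀ᶠ ε in 𝓝[>] (0 : ℝ), b < nonlocalEnergy n s ε E := by
  by_contra hcon
  have hfreq : ∃ᶠ ε in 𝓝[>] (0 : ℝ), 0 < ε ∧ nonlocalEnergy n s ε E ≤ b := by
    rw [not_eventually] at hcon
    refine (hcon.and_eventually self_mem_nhdsWithin).mono fun ε h => ⟨h.2, not_lt.1 h.1⟩
  -- If the energy stayed at most `b` along some `ε_k → 0`, the identity would give `‖χ - φ_k‖² ≤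
  -- ε_k^s b → 0` and quadratic energies at most `2b/c`. Fatou along an almost everywhere convergent
  -- subsequence then yields `c P_s(E) ≤ b`.
  obtain ⟨ε, hε, hεb⟩ := exists_seq_forall_of_frequently hfreq
  choose φ hm hφ h0 hEn hle using fun k => exists_isBoundedSolution hn hs (hεb k).1 hE hfin
  set χ : EuclideanSpace ℝ (Fin n) → ℝ := E.indicator fun _ => 1 with hχ
  have hχm : Measurable χ := measurable_const.indicator hE
  have hc := fracConst_pos (n := n) hs
  have hεs (k) : 0 < ε k ^ s := Real.rpow_pos_of_pos (hεb k).1 s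
  have hJ (k) : ENNReal.ofReal (∫ x in E, (1 - φ k x)) ≤ ENNReal.ofReal (ε k ^ s * b) := by
    rw [← nonlocalEnergy_eq hn hs (hεb k).1 (hφ k)]
    exact ENNReal.ofReal_le_ofReal (mul_le_mul_of_nonneg_left (hεb k).2 (hεs k).le)
  have hQ (k) : ∫⁻ z : EuclideanSpace ℝ (Fin n) × EuclideanSpace ℝ (Fin n),
      ENNReal.ofReal ((φ k z.1 - φ k z.2) ^ 2 * fracKernel n s (z.1 - z.2))
        ∂(volume.prod volume) ≤ ENNReal.ofReal (2 * b / fracConst n s) := by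
    have h1 := le_add_self.trans ((hEn k).symm.le.trans (hJ k))
    have h2 : ε k ^ s * b = ε k ^ s * fracConst n s / 2 * (2 * b / fracConst n s) := by
      field_simp
    have hpos : 0 < ε k ^ s * fracConst n s / 2 := by have := hεs k; positivity
    rw [h2, ENNReal.ofReal_mul hpos.le] at h1
    exact (ENNReal.mul_le_mul_iff_right (by simpa using hpos) ENNReal.ofReal_ne_top).1 h1
  have hL2 (k) : ∫⁻ x, ENNReal.ofReal ((χ x - φ k x) ^ 2) ≤ ENNReal.ofReal (ε k ^ s * b) :=
    le_self_add.trans ((hEn k).symm.le.trans (hJ k))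
  have hlim : Tendsto (fun k => ENNReal.ofReal (ε k ^ s * b)) atTop (𝓝 0) := by
    rw [← ENNReal.ofReal_zero]
    refine (ENNReal.continuous_ofReal.tendsto 0).comp ?_
    have h1 : Tendsto (fun x : ℝ => x ^ s * b) (𝓝 0) (𝓝 ((0 : ℝ) ^ s * b)) :=
      ((Real.continuousAt_rpow_const 0 s (Or.inr hs.1.le)).tendsto).mul_const b
    rw [Real.zero_rpow hs.1.ne', zero_mul] at h1
    exact h1.comp (hε.mono_right nhdsWithin_le_nhds)
  have hmeas : TendstoInMeasure volume (fun k x => (χ x - φ k x) ^ 2) atTop (fun _ => (0 : ℝ)) := by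
    refine tendstoInMeasure_of_tendsto_eLpNorm (p := 1) one_ne_zero
      (fun k => ((hχm.sub (hm k)).pow_const 2).aestronglyMeasurable)
      aestronglyMeasurable_const ?_
    refine tendsto_of_tendsto_of_tendsto_of_le_of_le tendsto_const_nhds hlim
      (fun _ => zero_le) fun k => ?_
    refine le_trans (le_of_eq ?_) (hL2 k)
    rw [eLpNorm_one_eq_lintegral_enorm]
    refine lintegral_congr fun x => ?_
    simp only [Pi.sub_apply, sub_zero]
    rw [Real.enorm_of_nonneg (sq_nonneg _)]
  obtain ⟨k, hk, hae⟩ := hmeas.exists_seq_tendsto_ae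
  have hae' : ∀ᵐ x, Tendsto (fun i => φ (k i) x) atTop (𝓝 (χ x)) := by
    filter_upwards [hae] with x hx
    have h1 : Tendsto (fun i => χ x - φ (k i) x) atTop (𝓝 0) := by
      rw [tendsto_zero_iff_abs_tendsto_zero]
      have := (Real.continuous_sqrt.tendsto 0).comp hx
      simpa [Function.comp_def, Real.sqrt_sq_eq_abs] using this
    simpa using (tendsto_const_nhds (x := χ x)).sub h1
  have hfatou : gagliardo n s χ ≤ ENNReal.ofReal (2 * b / fracConst n s) := by
    rw [← lintegral_sq_indicator_eq_gagliardo hE]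
    have h1 := (Measure.quasiMeasurePreserving_fst (μ := volume)
      (ν := (volume : Measure (EuclideanSpace ℝ (Fin n))))).ae hae'
    have h2 := (Measure.quasiMeasurePreserving_snd (ν := volume)
      (μ := (volume : Measure (EuclideanSpace ℝ (Fin n))))).ae hae'
    calc _ = ∫⁻ z : EuclideanSpace ℝ (Fin n) × EuclideanSpace ℝ (Fin n), liminf (fun i =>
          ENNReal.ofReal ((φ (k i) z.1 - φ (k i) z.2) ^ 2 * fracKernel n s (z.1 - z.2))) atTop
            ∂(volume.prod volume) := by
          refine lintegral_congr_ae ?_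
          filter_upwards [h1, h2] with z hz1 hz2
          exact ((ENNReal.continuous_ofReal.tendsto _).comp
            (((hz1.sub hz2).pow 2).mul_const _)).liminf_eq.symm
      _ ≤ liminf (fun i => ∫⁻ z : EuclideanSpace ℝ (Fin n) × EuclideanSpace ℝ (Fin n),
          ENNReal.ofReal ((φ (k i) z.1 - φ (k i) z.2) ^ 2 * fracKernel n s (z.1 - z.2))
            ∂(volume.prod volume)) atTop := lintegral_liminf_le fun i => by
          have := hm (k i)
          fun_prop
      _ ≤ liminf (fun _ : ℕ => ENNReal.ofReal (2 * b / fracConst n s)) atTop :=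
          liminf_le_liminf (Eventually.of_forall fun i => hQ (k i))
      _ = _ := liminf_const _
  rw [fracPerimeter_eq_gagliardo, ENNReal.toReal_mul] at hb
  have hb0 : 0 ≤ b := by
    have h1 := h0 0
    rw [← nonlocalEnergy_eq hn hs (hεb 0).1 (hφ 0)] at h1
    exact (nonneg_of_mul_nonneg_right h1 (hεs 0)).trans (hεb 0).2
  have h3 := ENNReal.toReal_le_of_le_ofReal (by positivity) hfatou
  rw [le_div_iff₀ hc] at h3
  simp only [ENNReal.toReal_inv, ENNReal.toReal_ofNat] at hb
  nlinarith

end Energy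

/-! ### Finite perimeter controls translations -/

section Perimeter

variable {n : ℕ}

lemma divergence_smul_const {f : EuclideanSpace ℝ (Fin n) → ℝ} (hf : Differentiable ℝ f)
    (v x : EuclideanSpace ℝ (Fin n)) :
    divergence n (fun y => f y • v) x = fderiv ℝ f x v := by
  have h (w) : fderiv ℝ (fun y => f y • v) x w = fderiv ℝ f x w • v := by
    rw [fderiv_smul_const (hf x)]; rfl
  conv_rhs => rw [← (EuclideanSpace.basisFun (Fin n) ℝ).sum_repr v, map_sum]
  refine Finset.sum_congr rfl fun i _ => ?_
  rw [h]
  simp [mul_comm]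

lemma ofReal_integral_divergence_le_perimeter (E : Set (EuclideanSpace ℝ (Fin n)))
    {g : EuclideanSpace ℝ (Fin n) → EuclideanSpace ℝ (Fin n)} (hg : ContDiff ℝ 1 g)
    (hc : HasCompactSupport g) (h1 : ∀ x, ‖g x‖ ≤ 1) :
    ENNReal.ofReal (∫ x in E, divergence n g x) ≤ perimeter n E :=
  le_iSup₂_of_le g hg (le_iSup₂_of_le hc h1 le_rfl)

/-- The field `f · h/‖h‖` is admissible in the perimeter, and its divergence is the directional
derivative of `f`. -/
lemma integral_fderiv_le_perimeter {E : Set (EuclideanSpace ℝ (Fin n))} (hP : perimeter n E ≠ ⊤)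
    {f : EuclideanSpace ℝ (Fin n) → ℝ} (hf : ContDiff ℝ 1 f) (hc : HasCompactSupport f)
    (h1 : ∀ x, |f x| ≤ 1) (h : EuclideanSpace ℝ (Fin n)) :
    ∫ x in E, fderiv ℝ f x h ≤ (perimeter n E).toReal * ‖h‖ := by
  rcases eq_or_ne h 0 with rfl | hh
  · simp
  have hp : 0 < ‖h‖ := norm_pos_iff.2 hh
  have h2 := ofReal_integral_divergence_le_perimeter E (g := fun x => f x • (‖h‖⁻¹ • h))
    (hf.smul contDiff_const) hc.smul_right fun x => by
      rw [norm_smul, norm_smul, norm_inv, norm_norm, inv_mul_cancel₀ hp.ne', mul_one]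
      exact h1 x
  simp_rw [divergence_smul_const (hf.differentiable one_ne_zero), map_smul, smul_eq_mul,
    integral_const_mul] at h2
  have h3 := (ENNReal.ofReal_le_iff_le_toReal hP).1 h2
  rwa [inv_mul_le_iff₀ hp, mul_comm] at h3

lemma abs_integral_fderiv_le_perimeter {E : Set (EuclideanSpace ℝ (Fin n))}
    (hP : perimeter n E ≠ ⊤) {f : EuclideanSpace ℝ (Fin n) → ℝ} (hf : ContDiff ℝ 1 f)
    (hc : HasCompactSupport f) (h1 : ∀ x, |f x| ≤ 1) (h : EuclideanSpace ℝ (Fin n)) :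
    |∫ x in E, fderiv ℝ f x h| ≤ (perimeter n E).toReal * ‖h‖ := by
  refine abs_le'.2 ⟨integral_fderiv_le_perimeter hP hf hc h1 h, ?_⟩
  have := integral_fderiv_le_perimeter hP hf hc h1 (-h)
  simpa [integral_neg] using this

/-- Each translate of `f` is again admissible, so the derivative of `τ ↦ ∫_E f(x + τh) dx` is
bounded uniformly, and the mean value inequality on `[0,1]` concludes. -/
lemma abs_integral_sub_translate_le_perimeter {E : Set (EuclideanSpace ℝ (Fin n))}
    (hfin : volume E ≠ ⊤) (hP : perimeter n E ≠ ⊤) {f : EuclideanSpace ℝ (Fin n) → ℝ}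
    (hf : ContDiff ℝ 1 f) (hc : HasCompactSupport f) (h1 : ∀ x, |f x| ≤ 1)
    (h : EuclideanSpace ℝ (Fin n)) :
    |(∫ x in E, f (x + h)) - ∫ x in E, f x| ≤ (perimeter n E).toReal * ‖h‖ := by
  obtain ⟨L, hL⟩ := hf.lipschitzWith_of_hasCompactSupport hc one_ne_zero
  have hfd := hf.differentiable one_ne_zero
  have hint (τ : ℝ) : IntegrableOn (fun x => f (x + τ • h)) E :=
    Integrable.mono' (g := fun _ => (1 : ℝ)) (integrableOn_const hfin)
      (by have := hf.continuous; fun_prop) (Eventually.of_forall fun x => h1 _)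
  have hder (τ : ℝ) : HasDerivAt (fun τ : ℝ => ∫ x in E, f (x + τ • h))
      (∫ x in E, fderiv ℝ f (x + τ • h) h) τ := by
    refine (hasDerivAt_integral_of_dominated_loc_of_deriv_le (s := univ)
      (bound := fun _ => L * ‖h‖) univ_mem (Eventually.of_forall fun τ => (hint τ).1) (hint τ)
      (F' := fun τ x => fderiv ℝ f (x + τ • h) h) ?_ ?_ (integrableOn_const hfin) ?_).2
    · have := hf.continuous_fderiv one_ne_zero
      exact Continuous.aestronglyMeasurable (by fun_prop)
    · refine Eventually.of_forall fun x τ _ => ?_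
      exact (ContinuousLinearMap.le_opNorm _ _).trans
        (mul_le_mul_of_nonneg_right (norm_fderiv_le_of_lipschitz ℝ hL) (norm_nonneg h))
    · refine Eventually.of_forall fun x τ _ => ?_
      have h2 : HasDerivAt (fun τ : ℝ => x + τ • h) h τ := by
        simpa using ((hasDerivAt_id τ).smul_const h).const_add x
      exact (hfd _).hasFDerivAt.comp_hasDerivAt τ h2
  have key := norm_image_sub_le_of_norm_deriv_le_segment_01'
    (f := fun τ : ℝ => ∫ x in E, f (x + τ • h)) (C := (perimeter n E).toReal * ‖h‖)
    (fun τ _ => (hder τ).hasDerivWithinAt) fun τ _ => by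
      have hcomp : ContDiff ℝ 1 (fun x => f (x + τ • h)) := hf.comp (contDiff_id.add contDiff_const)
      have := abs_integral_fderiv_le_perimeter hP hcomp
        (hc.comp_homeomorph (Homeomorph.addRight (τ • h))) (fun x => h1 _) h
      simpa [fderiv_comp_add_right] using this
  simpa using key

/-- Smooth functions detect the measure of a difference of sets. -/
lemma measureReal_sdiff_le_of_forall_integral_sub_le {A B : Set (EuclideanSpace ℝ (Fin n))}
    (hA : MeasurableSet A) (hB : MeasurableSet B) (hAfin : volume A ≠ ⊤)
    {C : ℝ} (h : ∀ f : EuclideanSpace ℝ (Fin n) → ℝ, ContDiff ℝ 1 f → HasCompactSupport f →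
      (∀ x, |f x| ≤ 1) → (∫ x in A, f x) - ∫ x in B, f x ≤ C) :
    volume.real (A \ B) ≤ C := by
  have hNfin : volume (A \ B) ≠ ⊤ := measure_ne_top_of_subset sdiff_subset hAfin
  refine le_of_forall_pos_le_add fun δ hδ => ?_
  have hδ' : ENNReal.ofReal (δ / 2) ≠ 0 := by simpa using hδ
  -- The test function is a cut-off equal to 1 on a compact `K ⊆ A \ B` and supported near `K` in an
  -- open `U`. On `B \ A` it contributes at most `|U \ K|`, and `A ∩ B` cancels; the two
  -- approximations cost `δ/2` each.
  obtain ⟨K, hKN, hK, hKδ⟩ := (hA.diff hB).exists_isCompact_sdiff_lt hNfin hδ'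
  obtain ⟨U, hKU, hU, -, hUδ⟩ := hK.measurableSet.exists_isOpen_sdiff_lt
    (hK.measure_lt_top (μ := volume)).ne hδ'
  obtain ⟨f, hf, hfr, hfs, hf1⟩ := exists_contMDiff_support_eq_eq_one_iff (n := 1)
    (modelWithCornersSelf ℝ (EuclideanSpace ℝ (Fin n)))
    (hU.inter (Metric.isOpen_thickening (δ := 1) (E := K))) hK.isClosed
    (subset_inter hKU (Metric.self_subset_thickening one_pos K))
  have hf01 (x) : f x ∈ Icc (0 : ℝ) 1 := hfr ⟨x, rfl⟩
  have hfabs (x) : |f x| ≤ 1 := by rw [abs_of_nonneg (hf01 x).1]; exact (hf01 x).2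
  have hfc : HasCompactSupport f := by
    refine Metric.isCompact_of_isClosed_isBounded (isClosed_tsupport f) ?_
    refine Bornology.IsBounded.closure ?_
    rw [hfs]
    exact (hK.isBounded.thickening).subset inter_subset_right
  have hfC : ContDiff ℝ 1 f := hf.contDiff
  have hfi : Integrable f := hfC.continuous.integrable_of_hasCompactSupport hfc
  have h1 := h f hfC hfc hfabs
  have e1 : ∫ x in A, f x = (∫ x in A ∩ B, f x) + ∫ x in A \ B, f x :=
    (integral_inter_add_sdiff hB hfi.integrableOn).symm
  have e2 : ∫ x in B, f x = (∫ x in B ∩ A, f x) + ∫ x in B \ A, f x :=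
    (integral_inter_add_sdiff hA hfi.integrableOn).symm
  have e3 : volume.real K ≤ ∫ x in A \ B, f x := by
    calc volume.real K = ∫ x in K, f x := by
          rw [setIntegral_congr_fun hK.measurableSet (g := fun _ => (1 : ℝ))
            fun x hx => (hf1 x).1 hx]
          simp
      _ ≤ _ := setIntegral_mono_set hfi.integrableOn (Eventually.of_forall fun x => (hf01 x).1)
          (Eventually.of_forall hKN)
  have e4 : ∫ x in B \ A, f x ≤ volume.real (U \ K) := by
    have hUKfin : volume (U \ K) ≠ ⊤ := (hUδ.trans ENNReal.ofReal_lt_top).ne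
    calc ∫ x in B \ A, f x ≤ ∫ x in B \ A, (U \ K).indicator (fun _ => (1 : ℝ)) x := by
          refine setIntegral_mono_on hfi.integrableOn
            (((integrable_indicator_iff (hU.measurableSet.diff hK.measurableSet)).2
              (integrableOn_const hUKfin)).integrableOn) (hB.diff hA) fun x hx => ?_
          by_cases hxU : x ∈ U
          · have hxK : x ∉ K := fun hxK => hx.2 (hKN hxK).1
            rw [indicator_of_mem (show x ∈ U \ K from ⟨hxU, hxK⟩)]
            exact (hf01 x).2
          · have : x ∉ Function.support f := by rw [hfs]; exact fun h => hxU h.1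
            rw [Function.notMem_support.1 this]
            exact indicator_nonneg (fun _ _ => zero_le_one) _
      _ ≤ ∫ x, (U \ K).indicator (fun _ => (1 : ℝ)) x :=
          setIntegral_le_integral ((integrable_indicator_iff
            (hU.measurableSet.diff hK.measurableSet)).2 (integrableOn_const hUKfin))
            (Eventually.of_forall fun x => indicator_nonneg (fun _ _ => zero_le_one) _)
      _ = volume.real (U \ K) := by
          rw [integral_indicator_const _ (hU.measurableSet.diff hK.measurableSet)]; simp
  have e5 : volume.real (U \ K) ≤ δ / 2 :=
    ENNReal.toReal_le_of_le_ofReal (by positivity) hUδ.le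
  have e6 : volume.real (A \ B) = volume.real K + volume.real ((A \ B) \ K) := by
    rw [← measureReal_inter_add_sdiff (s := A \ B) hK.measurableSet hNfin, inter_eq_right.2 hKN]
  have e7 : volume.real ((A \ B) \ K) ≤ δ / 2 :=
    ENNReal.toReal_le_of_le_ofReal (by positivity) hKδ.le
  rw [e1, e2, inter_comm B A] at h1
  linarith

lemma volume_sdiff_translate_le {E : Set (EuclideanSpace ℝ (Fin n))} (hE : MeasurableSet E)
    (hfin : volume E ≠ ⊤) (hP : perimeter n E ≠ ⊤) (h : EuclideanSpace ℝ (Fin n)) :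
    volume (E \ (fun x => x - h) ⁻¹' E) ≤ perimeter n E * ENNReal.ofReal ‖h‖ := by
  have hmp : MeasurePreserving (fun x : EuclideanSpace ℝ (Fin n) => x - h) volume volume :=
    measurePreserving_sub_right volume h
  have hBm : MeasurableSet ((fun x => x - h) ⁻¹' E) := hmp.measurable hE
  have h1 := measureReal_sdiff_le_of_forall_integral_sub_le hE hBm hfin
    (C := (perimeter n E).toReal * ‖h‖) fun f hf hc hf1 => by
      have h2 := abs_integral_sub_translate_le_perimeter hfin hP hf hc hf1 h
      have h3 : ∫ x in (fun x => x - h) ⁻¹' E, f x = ∫ x in E, f (x + h) := by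
        simpa using hmp.setIntegral_preimage_emb
          (MeasurableEquiv.subRight h).measurableEmbedding (fun x => f (x + h)) E
      rw [h3]
      linarith [(abs_le.1 h2).1]
  rw [← ENNReal.ofReal_toReal hP, ← ENNReal.ofReal_mul ENNReal.toReal_nonneg]
  exact (ENNReal.le_ofReal_iff_toReal_le (measure_ne_top_of_subset sdiff_subset hfin)
    (by positivity)).2 h1

lemma lintegral_indicator_sub_translate_le {E : Set (EuclideanSpace ℝ (Fin n))}
    (hE : MeasurableSet E) (hfin : volume E ≠ ⊤) (hP : perimeter n E ≠ ⊤)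
    (h : EuclideanSpace ℝ (Fin n)) :
    ∫⁻ x, ‖E.indicator (fun _ => (1 : ℝ)) x - E.indicator (fun _ => (1 : ℝ)) (x - h)‖ₑ ≤
      2 * perimeter n E * ENNReal.ofReal ‖h‖ := by
  have hmp : MeasurePreserving (fun x : EuclideanSpace ℝ (Fin n) => x - h) volume volume :=
    measurePreserving_sub_right volume h
  set B := (fun x => x - h) ⁻¹' E with hB
  have hBm : MeasurableSet B := hmp.measurable hE
  -- The other half of the symmetric difference is the one-sided estimate for `-h`, translated back.
  have e1 : volume (B \ E) ≤ perimeter n E * ENNReal.ofReal ‖h‖ := by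
    have h1 := volume_sdiff_translate_le hE hfin hP (-h)
    rw [norm_neg, ← hmp.measure_preimage
      (hE.diff (measurable_sub_const (-h) hE)).nullMeasurableSet] at h1
    simpa [hB, preimage_sdiff, preimage_preimage] using h1
  calc _ ≤ ∫⁻ x, ((E \ B).indicator (fun _ => (1 : ℝ≥0∞)) x +
        (B \ E).indicator (fun _ => (1 : ℝ≥0∞)) x) := by
        refine lintegral_mono fun x => ?_
        by_cases hx : x ∈ E <;> by_cases hx' : x - h ∈ E <;> simp [hB, hx, hx']
    _ = volume (E \ B) + volume (B \ E) := by
        rw [lintegral_add_left (measurable_const.indicator (hE.diff hBm)),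
          lintegral_indicator_const (hE.diff hBm), lintegral_indicator_const (hBm.diff hE),
          one_mul, one_mul]
    _ ≤ perimeter n E * ENNReal.ofReal ‖h‖ + perimeter n E * ENNReal.ofReal ‖h‖ :=
        add_le_add (volume_sdiff_translate_le hE hfin hP h) e1
    _ = _ := by ring

end Perimeter

/-! ### Continuity of the `s`-perimeter and semicontinuity of the perimeter -/

section GammaLimit

variable {n : ℕ} {s : ℝ}

lemma fracPerimeter_ne_top (hn : 1 ≤ n) (hs : s ∈ Ioo (0 : ℝ) 1)
    {E : Set (EuclideanSpace ℝ (Fin n))} (hE : MeasurableSet E) (hfin : volume E ≠ ⊤)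
    (hP : perimeter n E ≠ ⊤) : fracPerimeter n s E ≠ ⊤ := by
  rw [fracPerimeter_eq_gagliardo]
  refine ENNReal.mul_ne_top (by simp) (gagliardo_ne_top_of_translate hn hs
    (measurable_const.indicator hE) ?_ (ENNReal.mul_ne_top (by simp) hP)
    (lintegral_indicator_sub_translate_le hE hfin hP))
  exact (memLp_one_iff_integrable.1 (memLp_indicator_const 1 hE (1 : ℝ) (Or.inr hfin))).2.ne

/-- On sets of bounded perimeter the `s`-perimeter is continuous with respect to the measure of
the symmetric difference. -/
lemma fracPerimeter_le_add (hn : 1 ≤ n) (hs : s ∈ Ioo (0 : ℝ) 1)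
    {E F : Set (EuclideanSpace ℝ (Fin n))} (hE : MeasurableSet E) (hF : MeasurableSet F)
    (hEfin : volume E ≠ ⊤) (hFfin : volume F ≠ ⊤) (hPE : perimeter n E ≠ ⊤)
    (hPF : perimeter n F ≠ ⊤) {r : ℝ} (hr : 0 < r) :
    fracPerimeter n s F ≤ fracPerimeter n s E +
      ((perimeter n E + perimeter n F) * ENNReal.ofReal (nearMass n s r) +
        volume (F ∆ E) * ENNReal.ofReal (farMass n s r)) := by
  set χE : EuclideanSpace ℝ (Fin n) → ℝ := E.indicator fun _ => 1
  set χF : EuclideanSpace ℝ (Fin n) → ℝ := F.indicator fun _ => 1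
  have hmE : Measurable χE := measurable_const.indicator hE
  have hmF : Measurable χF := measurable_const.indicator hF
  have htri : gagliardo n s χF ≤ gagliardo n s χE + gagliardo n s (fun x => χF x - χE x) := by
    unfold gagliardo
    rw [← lintegral_add_left (Measurable.lintegral_prod_right (by fun_prop))]
    refine lintegral_mono fun x => ?_
    rw [← lintegral_add_left (by fun_prop)]
    refine lintegral_mono fun y => ?_
    rw [← ENNReal.ofReal_add (mul_nonneg (abs_nonneg _) (fracKernel_nonneg _))
      (mul_nonneg (abs_nonneg _) (fracKernel_nonneg _)), ← add_mul]
    refine ENNReal.ofReal_le_ofReal (mul_le_mul_of_nonneg_right ?_ (fracKernel_nonneg _))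
    refine le_trans (le_of_eq ?_) (abs_add_le _ _)
    congr 1
    ring
  have hM (h : EuclideanSpace ℝ (Fin n)) :
      ∫⁻ x, ‖(χF x - χE x) - (χF (x - h) - χE (x - h))‖ₑ ≤
        (2 * (perimeter n E + perimeter n F)) * ENNReal.ofReal ‖h‖ := by
    calc _ ≤ ∫⁻ x, (‖χE x - χE (x - h)‖ₑ + ‖χF x - χF (x - h)‖ₑ) := by
          refine lintegral_mono fun x => ?_
          rw [show (χF x - χE x) - (χF (x - h) - χE (x - h)) =
            (χF x - χF (x - h)) - (χE x - χE (x - h)) by ring, add_comm]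
          exact enorm_sub_le
      _ ≤ 2 * perimeter n E * ENNReal.ofReal ‖h‖ + 2 * perimeter n F * ENNReal.ofReal ‖h‖ := by
          rw [lintegral_add_left (by fun_prop)]
          exact add_le_add (lintegral_indicator_sub_translate_le hE hEfin hPE h)
            (lintegral_indicator_sub_translate_le hF hFfin hPF h)
      _ = _ := by ring
  have hL1 : ∫⁻ x, ‖χF x - χE x‖ₑ = volume (F ∆ E) := by
    rw [← lintegral_indicator_one (hF.symmDiff hE)]
    refine lintegral_congr fun x => ?_
    by_cases hxE : x ∈ E <;> by_cases hxF : x ∈ F <;> simp [χE, χF, hxE, hxF, mem_symmDiff]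
  -- Interpolation is applied to `χF - χE`: its `BV` bound is only the sum of the perimeters, but
  -- its `L¹` norm is the small quantity `|F ∆ E|`.
  have hw := gagliardo_le hn hs (hmF.sub hmE) hM hr
  rw [fracPerimeter_eq_gagliardo, fracPerimeter_eq_gagliardo]
  calc 2⁻¹ * gagliardo n s χF
      ≤ 2⁻¹ * (gagliardo n s χE + (2 * (perimeter n E + perimeter n F) *
          ENNReal.ofReal (nearMass n s r) +
          2 * volume (F ∆ E) * ENNReal.ofReal (farMass n s r))) := by
        rw [← hL1]
        gcongr
        exact htri.trans (by gcongr; exact hw)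
    _ = 2⁻¹ * gagliardo n s χE + (2⁻¹ * 2) * ((perimeter n E + perimeter n F) *
          ENNReal.ofReal (nearMass n s r) + volume (F ∆ E) * ENNReal.ofReal (farMass n s r)) := by
        ring
    _ = _ := by rw [ENNReal.inv_mul_cancel two_ne_zero ENNReal.ofNat_ne_top, one_mul]

lemma toReal_fracPerimeter_le_add (hn : 1 ≤ n) (hs : s ∈ Ioo (0 : ℝ) 1)
    {E F : Set (EuclideanSpace ℝ (Fin n))} (hE : MeasurableSet E) (hF : MeasurableSet F)
    (hEfin : volume E ≠ ⊤) (hFfin : volume F ≠ ⊤) (hPE : perimeter n E ≠ ⊤)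
    (hPF : perimeter n F ≠ ⊤) {r : ℝ} (hr : 0 < r) :
    (fracPerimeter n s F).toReal ≤ (fracPerimeter n s E).toReal +
      (((perimeter n E).toReal + (perimeter n F).toReal) * nearMass n s r +
        volume.real (F ∆ E) * farMass n s r) := by
  have h := fracPerimeter_le_add hn hs hE hF hEfin hFfin hPE hPF hr
  have h1 := fracPerimeter_ne_top hn hs hE hEfin hPE
  have hd : volume (F ∆ E) ≠ ⊤ :=
    measure_ne_top_of_subset symmDiff_subset_union (measure_union_lt_top hFfin.lt_top
      hEfin.lt_top).ne
  have h2 : (perimeter n E + perimeter n F) * ENNReal.ofReal (nearMass n s r) ≠ ⊤ :=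
    ENNReal.mul_ne_top (ENNReal.add_ne_top.2 ⟨hPE, hPF⟩) ENNReal.ofReal_ne_top
  have h3 : volume (F ∆ E) * ENNReal.ofReal (farMass n s r) ≠ ⊤ :=
    ENNReal.mul_ne_top hd ENNReal.ofReal_ne_top
  have h4 := ENNReal.toReal_mono (ENNReal.add_ne_top.2 ⟨h1, ENNReal.add_ne_top.2 ⟨h2, h3⟩⟩) h
  rwa [ENNReal.toReal_add h1 (ENNReal.add_ne_top.2 ⟨h2, h3⟩), ENNReal.toReal_add h2 h3,
    ENNReal.toReal_mul, ENNReal.toReal_mul, ENNReal.toReal_add hPE hPF,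
    ENNReal.toReal_ofReal (nearMass_nonneg r), ENNReal.toReal_ofReal (farMass_nonneg r)] at h4

lemma perimeter_empty : perimeter n ∅ = 0 := by simp [perimeter]

lemma fracPerimeter_empty : fracPerimeter n s ∅ = 0 := by simp [fracPerimeter]

lemma continuous_divergence {g : EuclideanSpace ℝ (Fin n) → EuclideanSpace ℝ (Fin n)}
    (hg : ContDiff ℝ 1 g) : Continuous (divergence n g) := by
  unfold divergence
  have := hg.continuous_fderiv one_ne_zero
  refine continuous_finsetSum _ fun i _ => ?_
  exact (EuclideanSpace.proj (𝕜 := ℝ) i).continuous.comp (this.clm_apply continuous_const)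

lemma hasCompactSupport_divergence
    {g : EuclideanSpace ℝ (Fin n) → EuclideanSpace ℝ (Fin n)} (hc : HasCompactSupport g) :
    HasCompactSupport (divergence n g) := by
  refine (hc.fderiv (𝕜 := ℝ)).mono fun x hx => ?_
  contrapose! hx
  rw [Function.notMem_support] at hx ⊢
  simp [divergence, hx]

/-- Lower semicontinuity of the perimeter. -/
lemma eventually_lt_perimeter {ι : Type*} {l : Filter ι}
    {E : Set (EuclideanSpace ℝ (Fin n))} {u : ι → Set (EuclideanSpace ℝ (Fin n))}
    (hE : MeasurableSet E) (hu : ∀ i, MeasurableSet (u i))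
    (h : Tendsto (fun i => volume (u i ∆ E)) l (𝓝 0)) {a : ℝ≥0∞} (ha : a < perimeter n E) :
    ∀ᶠ i in l, a < perimeter n (u i) := by
  simp only [perimeter, lt_iSup_iff] at ha
  -- For one fixed admissible field the integral of the divergence is continuous in the set, and a
  -- supremum of continuous functionals is lower semicontinuous.
  obtain ⟨g, hg, hc, hg1, hag⟩ := ha
  have hi : Integrable (divergence n g) :=
    (continuous_divergence hg).integrable_of_hasCompactSupport (hasCompactSupport_divergence hc)
  have hsub {v : ι → Set (EuclideanSpace ℝ (Fin n))} (hv : ∀ i, v i ⊆ u i ∆ E) :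
      Tendsto (fun i => ∫ x in v i, divergence n g x) l (𝓝 0) :=
    hi.tendsto_setIntegral_nhds_zero (tendsto_of_tendsto_of_tendsto_of_le_of_le
      tendsto_const_nhds h (fun _ => zero_le) fun i => measure_mono (hv i))
  have h1 : Tendsto (fun i => ∫ x in u i, divergence n g x) l (𝓝 (∫ x in E, divergence n g x)) := by
    have h2 := ((tendsto_const_nhds (x := ∫ x in E, divergence n g x)).sub
      (hsub (v := fun i => E \ u i) fun i => subset_union_right)).add
      (hsub (v := fun i => u i \ E) fun i => subset_union_left)
    rw [sub_zero, add_zero] at h2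
    refine h2.congr fun i => ?_
    rw [← integral_inter_add_sdiff (hu i) hi.integrableOn (s := E),
      ← integral_inter_add_sdiff hE hi.integrableOn (s := u i), inter_comm E]
    ring
  filter_upwards [((ENNReal.continuous_ofReal.tendsto _).comp h1).eventually_const_lt hag] with i h3
  exact h3.trans_le (ofReal_integral_divergence_le_perimeter _ hg hc hg1)

end GammaLimit

/-! ### The two Γ-convergence inequalities -/

section MainTheorem

variable {n : ℕ} {s : ℝ}

lemma IntegrableSet.measurableSet_toSet (E : IntegrableSet n) : MeasurableSet E.toSet := E.1.2

lemma IntegrableSet.volume_toSet_ne_top (E : IntegrableSet n) : volume E.toSet ≠ ⊤ := E.2.ne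

lemma IntegrableSet.tendsto_volume_symmDiff {ι : Type*} {l : Filter ι} {u : ι → IntegrableSet n}
    {E : IntegrableSet n} (h : Tendsto u l (𝓝 E)) :
    Tendsto (fun i => volume ((u i).toSet ∆ E.toSet)) l (𝓝 0) := by
  have h1 := (continuous_subtype_val.tendsto E).comp h
  rw [tendsto_iff_edist_tendsto_0] at h1
  exact h1

lemma energy_of_ne_top {t ε : ℝ} {E : IntegrableSet n} (hP : perimeter n E.toSet ≠ ⊤) :
    energy n s t ε E =
      (((perimeter n E.toSet).toReal - t * nonlocalEnergy n s ε E.toSet : ℝ) : EReal) := by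
  rw [energy, ← EReal.coe_ennreal_toReal hP, EReal.coe_sub]

lemma energy_of_eq_top {t ε : ℝ} {E : IntegrableSet n} (hP : perimeter n E.toSet = ⊤) :
    energy n s t ε E = ⊤ := by
  rw [energy, hP, EReal.coe_ennreal_top, EReal.top_sub_coe]

lemma limitEnergy_of_ne_top (hn : 1 ≤ n) (hs : s ∈ Ioo (0 : ℝ) 1) {t : ℝ} {E : IntegrableSet n}
    (hP : perimeter n E.toSet ≠ ⊤) :
    limitEnergy n s t E = (((perimeter n E.toSet).toReal -
      t * fracConst n s * (fracPerimeter n s E.toSet).toReal : ℝ) : EReal) := by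
  have h1 := fracPerimeter_ne_top hn hs E.measurableSet_toSet E.volume_toSet_ne_top hP
  rw [limitEnergy, if_neg hP, ← EReal.coe_ennreal_toReal hP, ← EReal.coe_ennreal_toReal h1,
    EReal.coe_sub, EReal.coe_mul (t * _)]

/-- Since `J_ε ≤ c P_s`, the energy dominates the limit functional at every `ε`. This removes `ε`
from the liminf inequality, leaving only sets of finite perimeter to examine. -/
lemma le_energy (hn : 1 ≤ n) (hs : s ∈ Ioo (0 : ℝ) 1) {t ε a : ℝ} (ht : 0 < t) (hε : 0 < ε)
    {E : IntegrableSet n} (h : perimeter n E.toSet ≠ ⊤ → a ≤ (perimeter n E.toSet).toReal -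
      t * fracConst n s * (fracPerimeter n s E.toSet).toReal) :
    (a : EReal) ≤ energy n s t ε E := by
  by_cases hP : perimeter n E.toSet = ⊤
  · rw [energy_of_eq_top hP]
    exact le_top
  · rw [energy_of_ne_top hP, EReal.coe_le_coe_iff]
    refine (h hP).trans ?_
    have h1 := nonlocalEnergy_le hn hs hε E.measurableSet_toSet E.volume_toSet_ne_top
      (fracPerimeter_ne_top hn hs E.measurableSet_toSet E.volume_toSet_ne_top hP)
    rw [mul_assoc]
    gcongr

/-- The `liminf` inequality. -/
lemma limitEnergy_le_liminf_energy (hn : 1 ≤ n) (hs : s ∈ Ioo (0 : ℝ) 1) {t : ℝ} (ht : 0 < t)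
    (E : IntegrableSet n) (u : ℝ → IntegrableSet n) (hu : Tendsto u (𝓝[>] 0) (𝓝 E)) :
    limitEnergy n s t E ≤ liminf (fun ε => energy n s t ε (u ε)) (𝓝[>] 0) := by
  refine EReal.ge_of_forall_gt_iff_ge.1 fun a ha => ?_
  refine le_liminf_of_le (by isBoundedDefault) ?_
  have hd := IntegrableSet.tendsto_volume_symmDiff hu
  have hd' : Tendsto (fun ε => volume.real ((u ε).toSet ∆ E.toSet)) (𝓝[>] 0) (𝓝 0) := by
    have := (ENNReal.tendsto_toReal ENNReal.zero_ne_top).comp hd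
    exact this
  have hmE := E.measurableSet_toSet
  have hfE := E.volume_toSet_ne_top
  have hm (ε) := (u ε).measurableSet_toSet
  have hf (ε) := (u ε).volume_toSet_ne_top
  have hK : 0 < t * fracConst n s := mul_pos ht (fracConst_pos hs)
  set K := t * fracConst n s
  have hnear (c C : ℝ) (hc : 0 < c) : ∃ r : ℝ, 0 < r ∧ K * (C * nearMass n s r) ≤ c := by
    have h1 : Tendsto (fun r => K * (C * nearMass n s r)) (𝓝[>] 0) (𝓝 (K * (C * 0))) :=
      ((tendsto_nearMass hn hs.2).const_mul C).const_mul K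
    rw [mul_zero, mul_zero] at h1
    obtain ⟨r, h2, h3⟩ := ((h1.eventually_le_const hc).and self_mem_nhdsWithin).exists
    exact ⟨r, h3, h2⟩
  -- coercivity
  obtain ⟨r₀, hr₀, hr₀K⟩ := hnear 2⁻¹ 1 (by norm_num)
  set V := volume.real E.toSet + 1
  -- Comparison with the empty set at radius `r₀` gives `K P_s ≤ P/2 + K V farMass(r₀)`. Once `P >
  -- M`, this leaves `P - K P_s > |a|`.
  set M := 2 * (|a| + K * (V * farMass n s r₀))
  have hM0 : 0 ≤ M := by
    have := farMass_nonneg (n := n) (s := s) r₀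
    positivity
  have hV : ∀ᶠ ε in 𝓝[>] (0 : ℝ), volume.real (u ε).toSet ≤ V := by
    filter_upwards [hd'.eventually_le_const one_pos] with ε hε
    have h1 : volume.real (u ε).toSet ≤ volume.real (E.toSet ∪ (u ε).toSet ∆ E.toSet) := by
      refine measureReal_mono (fun x hx => ?_) ?_
      · by_cases hxE : x ∈ E.toSet
        · exact Or.inl hxE
        · exact Or.inr (Or.inl ⟨hx, hxE⟩)
      · exact (measure_union_lt_top hfE.lt_top (measure_symmDiff_ne_top (hf ε) hfE).lt_top).ne
    exact h1.trans ((measureReal_union_le _ _).trans (add_le_add le_rfl hε))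
  have hcoer : ∀ᶠ ε in 𝓝[>] (0 : ℝ), perimeter n (u ε).toSet ≠ ⊤ →
      M < (perimeter n (u ε).toSet).toReal → a ≤ (perimeter n (u ε).toSet).toReal -
        K * (fracPerimeter n s (u ε).toSet).toReal := by
    filter_upwards [hV] with ε hε hP hMP
    have h1 := toReal_fracPerimeter_le_add hn hs MeasurableSet.empty (hm ε) (by simp) (hf ε)
      (by simp [perimeter_empty]) hP hr₀
    simp only [fracPerimeter_empty, perimeter_empty, ENNReal.toReal_zero, zero_add,
      show (u ε).toSet ∆ ∅ = (u ε).toSet from symmDiff_bot _] at h1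
    have h2 := mul_le_mul_of_nonneg_left h1 hK.le
    have h3 : K * ((perimeter n (u ε).toSet).toReal * nearMass n s r₀) ≤
        (perimeter n (u ε).toSet).toReal * 2⁻¹ := by
      rw [one_mul] at hr₀K
      calc _ = (perimeter n (u ε).toSet).toReal * (K * nearMass n s r₀) := by ring
        _ ≤ _ := mul_le_mul_of_nonneg_left hr₀K ENNReal.toReal_nonneg
    have h4 : K * (volume.real (u ε).toSet * farMass n s r₀) ≤ K * (V * farMass n s r₀) :=
      mul_le_mul_of_nonneg_left (mul_le_mul_of_nonneg_right hε (farMass_nonneg r₀)) hK.le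
    have h5 : 2 * (|a| + K * (V * farMass n s r₀)) < (perimeter n (u ε).toSet).toReal := hMP
    rw [mul_add] at h2
    linarith [le_abs_self a]
  -- If the limit set has infinite perimeter, semicontinuity pushes the perimeters beyond `M` and
  -- coercivity finishes.
  by_cases hPE : perimeter n E.toSet = ⊤
  · have h1 := eventually_lt_perimeter hmE hm hd (a := ENNReal.ofReal M)
      (by rw [hPE]; exact ENNReal.ofReal_lt_top)
    filter_upwards [h1, hcoer, self_mem_nhdsWithin] with ε h2 h3 hε
    exact le_energy hn hs ht hε fun hP => h3 hP ((ENNReal.ofReal_lt_iff_lt_toReal hM0 hP).1 h2)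
  rw [limitEnergy_of_ne_top hn hs hPE, EReal.coe_lt_coe_iff] at ha
  set p := (perimeter n E.toSet).toReal
  set q := (fracPerimeter n s E.toSet).toReal
  -- One `δ` pays for the semicontinuity of the perimeter, the other two for the near and far parts
  -- of the change in `P_s`.
  obtain ⟨δ, hδ, hδa⟩ : ∃ δ > 0, a + 3 * δ = p - K * q :=
    ⟨(p - K * q - a) / 3, by simp only [K]; linarith, by ring⟩
  -- Perimeters above `M` fall under coercivity, so `p + M` bounds the sum of perimeters in the
  -- remaining case. The radius is fixed before `ε` is sent to zero.
  obtain ⟨r₁, hr₁, hr₁K⟩ := hnear δ (p + M) hδ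
  have hfar : ∀ᶠ ε in 𝓝[>] (0 : ℝ),
      K * (volume.real ((u ε).toSet ∆ E.toSet) * farMass n s r₁) ≤ δ := by
    have h1 := (hd'.mul_const (farMass n s r₁)).const_mul K
    rw [zero_mul, mul_zero] at h1
    exact h1.eventually_le_const hδ
  have hlsc : ∀ᶠ ε in 𝓝[>] (0 : ℝ), perimeter n (u ε).toSet ≠ ⊤ →
      p - δ ≤ (perimeter n (u ε).toSet).toReal := by
    rcases le_or_gt p δ with hpδ | hpδ
    · exact Eventually.of_forall fun ε _ => (sub_nonpos.2 hpδ).trans ENNReal.toReal_nonneg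
    · have h1 := eventually_lt_perimeter hmE hm hd (a := ENNReal.ofReal (p - δ))
        ((ENNReal.ofReal_lt_iff_lt_toReal (by linarith) hPE).2 (by linarith))
      filter_upwards [h1] with ε h2 hP
      exact ((ENNReal.ofReal_lt_iff_lt_toReal (by linarith) hP).1 h2).le
  filter_upwards [hcoer, hfar, hlsc, self_mem_nhdsWithin] with ε h1 h2 h3 hε
  refine le_energy hn hs ht hε fun hP => ?_
  rcases lt_or_ge M (perimeter n (u ε).toSet).toReal with h4 | h4
  · exact h1 hP h4
  have h5 := toReal_fracPerimeter_le_add hn hs hmE (hm ε) hfE (hf ε) hPE hP hr₁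
  have h6 := h3 hP
  have h7 : K * (fracPerimeter n s (u ε).toSet).toReal ≤ K * q + δ + δ := by
    refine (mul_le_mul_of_nonneg_left h5 hK.le).trans ?_
    rw [mul_add, mul_add]
    have h8 : (p + (perimeter n (u ε).toSet).toReal) * nearMass n s r₁ ≤
        (p + M) * nearMass n s r₁ :=
      mul_le_mul_of_nonneg_right (by linarith) (nearMass_nonneg r₁)
    have h9 := mul_le_mul_of_nonneg_left h8 hK.le
    linarith
  linarith

/-- The constant family is a recovery family. -/
lemma limsup_energy_le_limitEnergy (hn : 1 ≤ n) (hs : s ∈ Ioo (0 : ℝ) 1) {t : ℝ} (ht : 0 < t)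
    (E : IntegrableSet n) :
    limsup (fun ε => energy n s t ε E) (𝓝[>] 0) ≤ limitEnergy n s t E := by
  by_cases hP : perimeter n E.toSet = ⊤
  · rw [limitEnergy, if_pos hP]
    exact le_top
  rw [limitEnergy_of_ne_top hn hs hP]
  refine EReal.le_of_forall_lt_iff_le.1 fun a ha => ?_
  rw [EReal.coe_lt_coe_iff] at ha
  refine limsup_le_of_le (by isBoundedDefault) ?_
  -- The threshold `b` solves `P(E) - t b = a`.
  have h1 := eventually_lt_nonlocalEnergy hn hs E.measurableSet_toSet E.volume_toSet_ne_top
    (b := ((perimeter n E.toSet).toReal - a) / t) (by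
      rw [div_lt_iff₀ ht]
      linarith)
  filter_upwards [h1] with ε h2
  rw [energy_of_ne_top hP, EReal.coe_le_coe_iff]
  rw [div_lt_iff₀ ht] at h2
  linarith

end MainTheorem

theorem mainTheorem8 (n : ℕ) (hn : 1 ≤ n) (s : ℝ) (hs : s ∈ Set.Ioo (0 : ℝ) 1) :
    (∀ ε : ℝ, 0 < ε → ∀ E : IntegrableSet n,
      ∃ φ : EuclideanSpace ℝ (Fin n) → ℝ, IsBoundedSolution n s ε E.toSet φ ∧
        ∀ ψ : EuclideanSpace ℝ (Fin n) → ℝ, IsBoundedSolution n s ε E.toSet ψ →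
          ψ =ᵐ[volume] φ) ∧
    ∀ t : ℝ, 0 < t →
      GammaConverges (𝓝[>] (0 : ℝ)) (fun ε => energy n s t ε) (limitEnergy n s t) := by
  refine ⟨fun ε hε E => ?_, fun t ht => ⟨fun E u hu => limitEnergy_le_liminf_energy hn hs ht E u hu,
    fun E => ⟨fun _ => E, tendsto_const_nhds, limsup_energy_le_limitEnergy hn hs ht E⟩⟩⟩
  obtain ⟨φ, -, hφ, -⟩ := exists_isBoundedSolution hn hs hε E.measurableSet_toSet
    E.volume_toSet_ne_top
  exact ⟨φ, hφ, fun ψ hψ => hφ.ae_eq hn hs hε hψ⟩
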